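/- Let $\mathrm{Alt}_n$ be the space of skew-symmetric complex $n\times n$ matrices, let $V=\mathrm{Alt}_5^{\oplus 4}$, identify $\mathrm{Sym}^2(\mathbb C^4)$ with the space of symmetric complex $4\times4$ matrices, and let $G=SL_5(\mathbb C)\times GL_4(\mathbb C)$ act on $V$ by $\rho=\Lambda_2\otimes\Lambda_1$, $$\rho(A,B)(X_1,X_2,X_3,X_4)=(AX_1{}^tA,\;AX_2{}^tA,\;AX_3{}^tA,\;AX_4{}^tA)\,{}^tB .$$ Let $\mathrm{Pf}$ be the Pfaffian on $\mathrm{Alt}_4$, and for $X\in\mathrm{Alt}_5$ let $X^{(i)}\in\mathrm{Alt}_4$ be $X$ with its $i$-th row and column deleted. Let $\beta(X,Y)\in\mathbb C^5$ be the column vector whose $i$-th entry is $(-1)^{i-1}\bigl(\mathrm{Pf}(X^{(i)}+Y^{(i)})-\mathrm{Pf}(X^{(i)})-\mathrm{Pf}(Y^{(i)})\bigr)$, and for $i,j,k,l,m\in\{1,2,3,4\}$ define the polynomial $$[ijklm](X_1,X_2,X_3,X_4)={}^t\beta(X_i,X_j)\,X_k\,\beta(X_l,X_m)$$ on $V$.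 Put $$\begin{aligned} \varphi_{11}={}&160[31114](3[24132]-2[21342]-2[23412])+160[41112](3[32143]-2[34213]-2[31423])\\ &+160[21113](3[43124]-2[41234]-2[42314])\\ &+50([11233][11244]+[11322][11344]+[11422][11433])-288([13241]^2+[14321]^2+[12431]^2)\\ &+224([13241][14321]+[14321][12431]+[12431][13241]),\\ \varphi_{12}={}&400[31114][32224]-100([21113][22344]+[21114][22433])-100([12223][11344]+[12224][11433])\\ &+20[11422](4[31423]-[34213]-[32143])+20[11322](4[41324]-[43214]-[42134])\\ &-25([22144][11233]+[11244][22133])+368[13241][23142]\\ &+112([13241]([21342]+[23412])+[23142]([12341]+[13421]))\\ &+192([14321][23412]+[13421][24312])-208([14321][21342]+[12431][23412]). \end{aligned}$$ For a permutation $\sigma$ of $\{1,2,3,4\}$ and a polynomial $P$ on $V$ put $P^\sigma(X_1,\dots,X_4)=P(X_{\sigma^{-1}(1)},\dots,X_{\sigma^{-1}(4)})$. Define $\varphi_{ss}=\varphi_{11}^{(1\,s)}$ for all $s$, and, for $s\ne t$, $\varphi_{st}=\varphi_{12}^{\sigma}$ for any $\sigma$ with $\sigma^{-1}(1)=s$,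 $\sigma^{-1}(2)=t$ (this does not depend on the choice of $\sigma$, and $\varphi_{st}=\varphi_{ts}$). Let $\Phi:V\to\mathrm{Sym}^2(\mathbb C^4)$, $\Phi(X)=(\varphi_{st}(X))_{s,t}$. **Theorem.** (i) The map $\Phi$ is surjective. (ii) $(G,\rho,V)$ is a prehomogeneous vector space, that is, there is a proper algebraic subset $S\subset V$ such that $V\setminus S$ is a single $G$-orbit, and $f(X)=\det\Phi(X)$ is its irreducible relative invariant: $f$ is an irreducible homogeneous polynomial on $V$ of degree $40$; it corresponds to the rational character $(\det B)^{10}$, that is, $f(\rho(A,B)X)=(\det B)^{10}f(X)$ for all $(A,B)\in G$ and $X\in V$; and every irreducible polynomial $P$ on $V$ for which there is a rational character $\chi$ of $G$ with $P(\rho(g)X)=\chi(g)P(X)$ for all $g\in G$ and $X\in V$ is a nonzero constant multiple of $f$. -/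

import Mathlib

namespace QuinaryAlt

open Matrix

/-! ### Spaces of matrices and the representation -/

/-- `Alt_n`: the skew-symmetric complex `n × n` matrices. -/
def Alt (n : ℕ) : Submodule ℂ (Matrix (Fin n) (Fin n) ℂ) where
  carrier := {X | Xᵀ = -X}
  add_mem' := by
    intro X Y hX hY
    simp only [Set.mem_ofPred_eq] at *
    rw [transpose_add, hX, hY, neg_add]
  zero_mem' := by simp
  smul_mem' := by
    intro c X hX
    simp only [Set.mem_ofPred_eq] at *
    rw [transpose_smul, hX, smul_neg]

/-- `Sym²(ℂ^n)`, identified with the symmetric complex `n × n` matrices. -/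
def SymMat (n : ℕ) : Submodule ℂ (Matrix (Fin n) (Fin n) ℂ) where
  carrier := {S | Sᵀ = S}
  add_mem' := by
    intro X Y hX hY
    simp only [Set.mem_ofPred_eq] at *
    rw [transpose_add, hX, hY]
  zero_mem' := by simp
  smul_mem' := by
    intro c X hX
    simp only [Set.mem_ofPred_eq] at *
    rw [transpose_smul, hX]

/-- `Alt_5^{⊕4}`, quadruples of skew-symmetric `5 × 5` matrices. The four positions (and all
matrix indices) are numbered from `0` instead of `1`. -/
abbrev V : Type := Fin 4 → Alt 5

/-- The group `SL_5 × GL_4` over `ℂ`. -/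
abbrev G : Type := SpecialLinearGroup (Fin 5) ℂ × GL (Fin 4) ℂ

/-- `X ↦ A X ᵗA` on skew-symmetric matrices. -/
def conj {n : ℕ} (A : Matrix (Fin n) (Fin n) ℂ) : Alt n →ₗ[ℂ] Alt n where
  toFun X := ⟨A * X.1 * Aᵀ, by
    have h : X.1ᵀ = -X.1 := X.2
    change (A * X.1 * Aᵀ)ᵀ = -(A * X.1 * Aᵀ)
    simp [transpose_mul, h, Matrix.mul_assoc]⟩
  map_add' X Y := by
    ext1
    simp [Matrix.mul_add, Matrix.add_mul]
  map_smul' c X := by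
    ext1
    simp

/-- The representation `Λ₂ ⊗ Λ₁` of `SL_5 × GL_4` on `Alt_5^{⊕4}`:
`ρ(A, B)(X₁, …, X₄) = (A X₁ ᵗA, …, A X₄ ᵗA) ᵗB`, that is, the `i`-th component of the image is
`∑ j, B i j • A X_j ᵗA`. -/
def rho : Representation ℂ G V where
  toFun g :=
    { toFun := fun X i => ∑ j, (g.2 : Matrix (Fin 4) (Fin 4) ℂ) i j •
        conj (g.1 : Matrix (Fin 5) (Fin 5) ℂ) (X j)
      map_add' := by
        intro X Y
        funext i
        simp [Finset.sum_add_distrib]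
      map_smul' := by
        intro c X
        funext i
        simp [Finset.smul_sum, smul_comm c] }
  map_one' := by
    ext X i a b
    simp [conj, Matrix.one_apply]
  map_mul' := by
    intro g h
    refine LinearMap.ext fun X => funext fun i => ?_
    have hc : ∀ Y : Alt 5, conj ((g.1 * h.1 : SpecialLinearGroup (Fin 5) ℂ) :
        Matrix (Fin 5) (Fin 5) ℂ) Y = conj (g.1 : Matrix (Fin 5) (Fin 5) ℂ)
          (conj (h.1 : Matrix (Fin 5) (Fin 5) ℂ) Y) := by
      intro Y
      ext1
      simp [conj, transpose_mul, Matrix.mul_assoc]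
    simp only [Prod.fst_mul, Prod.snd_mul, hc, LinearMap.coe_mk, AddHom.coe_mk,
      Module.End.mul_apply, map_sum, map_smul, Units.val_mul, Matrix.mul_apply, Finset.sum_smul,
      Finset.smul_sum, smul_smul]
    exact Finset.sum_comm

/-! ### The bilinear map `β` and the invariants `[ijklm]` -/

/-- The Pfaffian on `Alt_4`. -/
def pf (X : Alt 4) : ℂ := X.1 0 1 * X.1 2 3 - X.1 0 2 * X.1 1 3 + X.1 0 3 * X.1 1 2

/-- `X^{(i)}`: delete the `i`-th row and the `i`-th column. -/
def del (i : Fin 5) (X : Alt 5) : Alt 4 :=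
  ⟨X.1.submatrix i.succAbove i.succAbove, by
    have h : X.1ᵀ = -X.1 := X.2
    change (X.1.submatrix i.succAbove i.succAbove)ᵀ = -(X.1.submatrix i.succAbove i.succAbove)
    rw [transpose_submatrix, h]
    rfl⟩

/-- The map `β : Alt_5 × Alt_5 → ℂ⁵`, with signs `+, -, +, -, +`. -/
def beta (X Y : Alt 5) : Fin 5 → ℂ := fun i =>
  (-1) ^ (i : ℕ) * (pf (del i X + del i Y) - pf (del i X) - pf (del i Y))

/-- `[ijklm](X) = ᵗβ(X_i, X_j) X_k β(X_l, X_m)`. -/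
def br (X : V) (i j k l m : Fin 4) : ℂ :=
  beta (X i) (X j) ⬝ᵥ ((X k).1 *ᵥ beta (X l) (X m))

/-! ### The map `Φ` -/

/-- `φ₁₁`. (All indices in the brackets are shifted by one: they run through `0, 1, 2, 3`.) -/
def phi11 (X : V) : ℂ :=
  160 * br X 2 0 0 0 3 * (3 * br X 1 3 0 2 1 - 2 * br X 1 0 2 3 1 - 2 * br X 1 2 3 0 1)
  + 160 * br X 3 0 0 0 1 * (3 * br X 2 1 0 3 2 - 2 * br X 2 3 1 0 2 - 2 * br X 2 0 3 1 2)
  + 160 * br X 1 0 0 0 2 * (3 * br X 3 2 0 1 3 - 2 * br X 3 0 1 2 3 - 2 * br X 3 1 2 0 3)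
  + 50 * (br X 0 0 1 2 2 * br X 0 0 1 3 3 + br X 0 0 2 1 1 * br X 0 0 2 3 3
      + br X 0 0 3 1 1 * br X 0 0 3 2 2)
  - 288 * (br X 0 2 1 3 0 ^ 2 + br X 0 3 2 1 0 ^ 2 + br X 0 1 3 2 0 ^ 2)
  + 224 * (br X 0 2 1 3 0 * br X 0 3 2 1 0 + br X 0 3 2 1 0 * br X 0 1 3 2 0
      + br X 0 1 3 2 0 * br X 0 2 1 3 0)

/-- `φ₁₂`. (All indices in the brackets are shifted by one: they run through `0, 1, 2, 3`.) -/
def phi12 (X : V) : ℂ :=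
  400 * br X 2 0 0 0 3 * br X 2 1 1 1 3
  - 100 * (br X 1 0 0 0 2 * br X 1 1 2 3 3 + br X 1 0 0 0 3 * br X 1 1 3 2 2)
  - 100 * (br X 0 1 1 1 2 * br X 0 0 2 3 3 + br X 0 1 1 1 3 * br X 0 0 3 2 2)
  + 20 * br X 0 0 3 1 1 * (4 * br X 2 0 3 1 2 - br X 2 3 1 0 2 - br X 2 1 0 3 2)
  + 20 * br X 0 0 2 1 1 * (4 * br X 3 0 2 1 3 - br X 3 2 1 0 3 - br X 3 1 0 2 3)
  - 25 * (br X 1 1 0 3 3 * br X 0 0 1 2 2 + br X 0 0 1 3 3 * br X 1 1 0 2 2)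
  + 368 * br X 0 2 1 3 0 * br X 1 2 0 3 1
  + 112 * (br X 0 2 1 3 0 * (br X 1 0 2 3 1 + br X 1 2 3 0 1)
      + br X 1 2 0 3 1 * (br X 0 1 2 3 0 + br X 0 2 3 1 0))
  + 192 * (br X 0 3 2 1 0 * br X 1 2 3 0 1 + br X 0 2 3 1 0 * br X 1 3 2 0 1)
  - 208 * (br X 0 3 2 1 0 * br X 1 0 2 3 1 + br X 0 1 3 2 0 * br X 1 2 3 0 1)

/-- The permuted quadruple `(X_{τ 0}, …, X_{τ 3})`. For `τ = σ⁻¹` this is `X ᵗσ`, where `σ` also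
denotes its permutation matrix, so that `P^σ(X) = P (permute σ⁻¹ X)`. -/
def permute (τ : Equiv.Perm (Fin 4)) (X : V) : V := fun i => X (τ i)

/-- A permutation that sends `0, 1` to `s, t` when `s ≠ t`; see `carry_zero` and `carry_one`. -/
def carry (s t : Fin 4) : Equiv.Perm (Fin 4) :=
  Equiv.swap 0 s * Equiv.swap 1 (Equiv.swap 0 s t)

theorem carry_zero : ∀ s t : Fin 4, s ≠ t → carry s t 0 = s := by decide

theorem carry_one : ∀ s t : Fin 4, s ≠ t → carry s t 1 = t := by decide

/-- The entries `φ_{st}` of `Φ`: `φ_{ss} = φ₁₁^{(1 s)}`, and `φ_{st} = φ₁₂^σ` for `s ≠ t`, where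
`σ⁻¹` sends the first two positions to `s` and `t` (`phi_eq_of_perm` shows that every such `σ`
gives the same polynomial). -/
def phi (s t : Fin 4) (X : V) : ℂ :=
  if s = t then phi11 (permute (Equiv.swap 0 s) X) else phi12 (permute (carry s t) X)

section WellDefined

theorem alt_apply {n : ℕ} (X : Alt n) (a b : Fin n) : X.1 a b = -X.1 b a := by
  have h : X.1ᵀ = -X.1 := X.2
  have := congrFun (congrFun h b) a
  simpa using this

theorem br_symm_left (X : V) (i j k l m : Fin 4) : br X i j k l m = br X j i k l m := by
  have h : beta (X i) (X j) = beta (X j) (X i) := by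
    funext a
    simp only [beta, add_comm (del a (X i))]
    ring
  rw [br, h, br]

theorem br_symm_right (X : V) (i j k l m : Fin 4) : br X i j k l m = br X i j k m l := by
  have h : beta (X l) (X m) = beta (X m) (X l) := by
    funext a
    simp only [beta, add_comm (del a (X l))]
    ring
  rw [br, h, br]

theorem br_anti (X : V) (i j k l m : Fin 4) : br X i j k l m = -br X l m k i j := by
  have h : (X k).1ᵀ = -(X k).1 := (X k).2
  rw [br, br, dotProduct_mulVec, ← mulVec_transpose, h, neg_mulVec, neg_dotProduct,
    dotProduct_comm]

theorem beta_zero (X Y : Alt 5) : beta X Y 0 =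
    X.1 1 2 * Y.1 3 4 - X.1 1 3 * Y.1 2 4 + X.1 1 4 * Y.1 2 3
      + Y.1 1 2 * X.1 3 4 - Y.1 1 3 * X.1 2 4 + Y.1 1 4 * X.1 2 3 := by
  change (-1) ^ 0 * ((X.1 1 2 + Y.1 1 2) * (X.1 3 4 + Y.1 3 4)
    - (X.1 1 3 + Y.1 1 3) * (X.1 2 4 + Y.1 2 4)
    + (X.1 1 4 + Y.1 1 4) * (X.1 2 3 + Y.1 2 3)
    - (X.1 1 2 * X.1 3 4 - X.1 1 3 * X.1 2 4 + X.1 1 4 * X.1 2 3)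
    - (Y.1 1 2 * Y.1 3 4 - Y.1 1 3 * Y.1 2 4 + Y.1 1 4 * Y.1 2 3)) = _
  ring

theorem beta_one (X Y : Alt 5) : beta X Y 1 =
    -(X.1 0 2 * Y.1 3 4 - X.1 0 3 * Y.1 2 4 + X.1 0 4 * Y.1 2 3
      + Y.1 0 2 * X.1 3 4 - Y.1 0 3 * X.1 2 4 + Y.1 0 4 * X.1 2 3) := by
  change (-1) ^ 1 * ((X.1 0 2 + Y.1 0 2) * (X.1 3 4 + Y.1 3 4)
    - (X.1 0 3 + Y.1 0 3) * (X.1 2 4 + Y.1 2 4)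
    + (X.1 0 4 + Y.1 0 4) * (X.1 2 3 + Y.1 2 3)
    - (X.1 0 2 * X.1 3 4 - X.1 0 3 * X.1 2 4 + X.1 0 4 * X.1 2 3)
    - (Y.1 0 2 * Y.1 3 4 - Y.1 0 3 * Y.1 2 4 + Y.1 0 4 * Y.1 2 3)) = _
  ring

theorem beta_two (X Y : Alt 5) : beta X Y 2 =
    X.1 0 1 * Y.1 3 4 - X.1 0 3 * Y.1 1 4 + X.1 0 4 * Y.1 1 3
      + Y.1 0 1 * X.1 3 4 - Y.1 0 3 * X.1 1 4 + Y.1 0 4 * X.1 1 3 := by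
  change (-1) ^ 2 * ((X.1 0 1 + Y.1 0 1) * (X.1 3 4 + Y.1 3 4)
    - (X.1 0 3 + Y.1 0 3) * (X.1 1 4 + Y.1 1 4)
    + (X.1 0 4 + Y.1 0 4) * (X.1 1 3 + Y.1 1 3)
    - (X.1 0 1 * X.1 3 4 - X.1 0 3 * X.1 1 4 + X.1 0 4 * X.1 1 3)
    - (Y.1 0 1 * Y.1 3 4 - Y.1 0 3 * Y.1 1 4 + Y.1 0 4 * Y.1 1 3)) = _
  ring

theorem beta_three (X Y : Alt 5) : beta X Y 3 =
    -(X.1 0 1 * Y.1 2 4 - X.1 0 2 * Y.1 1 4 + X.1 0 4 * Y.1 1 2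
      + Y.1 0 1 * X.1 2 4 - Y.1 0 2 * X.1 1 4 + Y.1 0 4 * X.1 1 2) := by
  change (-1) ^ 3 * ((X.1 0 1 + Y.1 0 1) * (X.1 2 4 + Y.1 2 4)
    - (X.1 0 2 + Y.1 0 2) * (X.1 1 4 + Y.1 1 4)
    + (X.1 0 4 + Y.1 0 4) * (X.1 1 2 + Y.1 1 2)
    - (X.1 0 1 * X.1 2 4 - X.1 0 2 * X.1 1 4 + X.1 0 4 * X.1 1 2)
    - (Y.1 0 1 * Y.1 2 4 - Y.1 0 2 * Y.1 1 4 + Y.1 0 4 * Y.1 1 2)) = _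
  ring

theorem beta_four (X Y : Alt 5) : beta X Y 4 =
    X.1 0 1 * Y.1 2 3 - X.1 0 2 * Y.1 1 3 + X.1 0 3 * Y.1 1 2
      + Y.1 0 1 * X.1 2 3 - Y.1 0 2 * X.1 1 3 + Y.1 0 3 * X.1 1 2 := by
  change (-1) ^ 4 * ((X.1 0 1 + Y.1 0 1) * (X.1 2 3 + Y.1 2 3)
    - (X.1 0 2 + Y.1 0 2) * (X.1 1 3 + Y.1 1 3)
    + (X.1 0 3 + Y.1 0 3) * (X.1 1 2 + Y.1 1 2)
    - (X.1 0 1 * X.1 2 3 - X.1 0 2 * X.1 1 3 + X.1 0 3 * X.1 1 2)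
    - (Y.1 0 1 * Y.1 2 3 - Y.1 0 2 * Y.1 1 3 + Y.1 0 3 * Y.1 1 2)) = _
  ring

theorem beta_cyclic (X Y Z : Alt 5) :
    beta X Y ᵥ* Z.1 + beta Y Z ᵥ* X.1 + beta Z X ᵥ* Y.1 = 0 := by
  have hd : ∀ (W : Alt 5) (a : Fin 5), W.1 a a = 0 := fun W a => by
    linear_combination (1 / 2) * alt_apply W a a
  funext a
  simp only [Pi.add_apply, vecMul, dotProduct, Fin.sum_univ_five, beta_zero, beta_one, beta_two,
    beta_three, beta_four, Pi.zero_apply]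
  fin_cases a <;>
  · simp only [Fin.zero_eta, Fin.mk_one, Fin.reduceFinMk, hd,
      alt_apply _ 1 0, alt_apply _ 2 0, alt_apply _ 3 0, alt_apply _ 4 0, alt_apply _ 2 1,
      alt_apply _ 3 1, alt_apply _ 4 1, alt_apply _ 3 2, alt_apply _ 4 2, alt_apply _ 4 3]
    ring

theorem br_cyclic (X : V) (i j k l m : Fin 4) :
    br X i j k l m + br X j k i l m + br X k i j l m = 0 := by
  simp only [br, dotProduct_mulVec, ← add_dotProduct, beta_cyclic, zero_dotProduct]

theorem phi12_swap_first (X : V) : phi12 (permute (Equiv.swap 0 1) X) = phi12 X := by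
  have e : ∀ i j k l m, br (permute (Equiv.swap 0 1) X) i j k l m =
      br X (Equiv.swap 0 1 i) (Equiv.swap 0 1 j) (Equiv.swap 0 1 k) (Equiv.swap 0 1 l)
        (Equiv.swap 0 1 m) := fun _ _ _ _ _ => rfl
  have e0 : (Equiv.swap 0 1 : Equiv.Perm (Fin 4)) 0 = 1 := rfl
  have e1 : (Equiv.swap 0 1 : Equiv.Perm (Fin 4)) 1 = 0 := rfl
  have e2 : (Equiv.swap 0 1 : Equiv.Perm (Fin 4)) 2 = 2 := rfl
  have e3 : (Equiv.swap 0 1 : Equiv.Perm (Fin 4)) 3 = 3 := rfl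
  simp only [phi12, e, e0, e1, e2, e3]
  grind [br_symm_left, br_symm_right, br_anti, br_cyclic]

theorem phi12_swap_last (X : V) : phi12 (permute (Equiv.swap 2 3) X) = phi12 X := by
  have e : ∀ i j k l m, br (permute (Equiv.swap 2 3) X) i j k l m =
      br X (Equiv.swap 2 3 i) (Equiv.swap 2 3 j) (Equiv.swap 2 3 k) (Equiv.swap 2 3 l)
        (Equiv.swap 2 3 m) := fun _ _ _ _ _ => rfl
  have e0 : (Equiv.swap 2 3 : Equiv.Perm (Fin 4)) 0 = 0 := rfl
  have e1 : (Equiv.swap 2 3 : Equiv.Perm (Fin 4)) 1 = 1 := rfl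
  have e2 : (Equiv.swap 2 3 : Equiv.Perm (Fin 4)) 2 = 3 := rfl
  have e3 : (Equiv.swap 2 3 : Equiv.Perm (Fin 4)) 3 = 2 := rfl
  simp only [phi12, e, e0, e1, e2, e3]
  grind [br_symm_left, br_symm_right, br_anti, br_cyclic]

theorem perm_eq_carry : ∀ τ : Equiv.Perm (Fin 4),
    τ = carry (τ 0) (τ 1) ∨ τ = carry (τ 0) (τ 1) * Equiv.swap 2 3 := by
  decide

theorem phi_eq_of_perm (τ : Equiv.Perm (Fin 4)) (X : V) :
    phi (τ 0) (τ 1) X = phi12 (permute τ X) := by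
  have hne : τ 0 ≠ τ 1 := fun h => absurd (τ.injective h) (by decide)
  rw [phi, if_neg hne]
  rcases perm_eq_carry τ with h | h
  · rw [← h]
  · conv_rhs => rw [h]
    exact (phi12_swap_last _).symm

theorem phi_symm (s t : Fin 4) (X : V) : phi s t X = phi t s X := by
  by_cases h : s = t
  · rw [h]
  · have h0 : (carry s t * Equiv.swap 0 1 : Equiv.Perm (Fin 4)) 0 = t := carry_one s t h
    have h1 : (carry s t * Equiv.swap 0 1 : Equiv.Perm (Fin 4)) 1 = s := carry_zero s t h
    have := phi_eq_of_perm (carry s t * Equiv.swap 0 1) X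
    rw [h0, h1] at this
    rw [this, phi, if_neg h]
    exact (phi12_swap_first _).symm

end WellDefined

/-- The map `Φ : Alt_5^{⊕4} → Sym²(ℂ⁴)`, `X ↦ (φ_{st}(X))`. -/
def Phi (X : V) : SymMat 4 :=
  ⟨Matrix.of fun s t => phi s t X, by
    change (Matrix.of fun s t => phi s t X)ᵀ = Matrix.of fun s t => phi s t X
    ext s t
    exact phi_symm t s X⟩

/-! ### Polynomials on `Alt_5^{⊕4}` and relative invariants -/

/-- The index set of the `40` linear coordinates on `Alt_5^{⊕4}`: the entries above the diagonal
of the four matrices. -/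
abbrev Coord : Type := Fin 4 × {p : Fin 5 × Fin 5 // p.1 < p.2}

/-- The linear coordinates on `Alt_5^{⊕4}`. -/
def coord : V ≃ₗ[ℂ] (Coord → ℂ) where
  toFun X c := (X c.1).1 c.2.1.1 c.2.1.2
  map_add' _ _ := rfl
  map_smul' _ _ := rfl
  invFun x k := ⟨Matrix.of fun a b =>
      if h : a < b then x (k, ⟨(a, b), h⟩) else if h : b < a then -x (k, ⟨(b, a), h⟩) else 0, by
    refine Matrix.ext fun a b => ?_
    simp only [transpose_apply, of_apply]
    rcases lt_trichotomy a b with h | h | h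
    · simp [h, h.not_gt]
    · simp [h]
    · simp [h, h.not_gt]⟩
  left_inv X := by
    funext k
    refine Subtype.ext (Matrix.ext fun a b => ?_)
    simp only [of_apply]
    rcases lt_trichotomy a b with h | h | h
    · simp [h]
    · subst h
      simp only [lt_self_iff_false, dite_false]
      linear_combination (-1 / 2) * alt_apply (X k) a a
    · simp only [h, h.not_gt, dite_false, dite_true]
      exact (alt_apply (X k) a b).symm
  right_inv x := by
    funext c
    obtain ⟨k, ⟨⟨a, b⟩, h⟩⟩ := c
    simp [show a < b from h]

/-- The value at `X` of a polynomial on `Alt_5^{⊕4}`. -/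
noncomputable def value (P : MvPolynomial Coord ℂ) (X : V) : ℂ := MvPolynomial.eval (coord X) P

/-- A proper algebraic subset of `Alt_5^{⊕4}` has a single orbit as its complement. (It is
automatically proper, because an orbit is not empty.) -/
def IsPrehomogeneous : Prop :=
  ∃ (I : Set (MvPolynomial Coord ℂ)) (X₀ : V),
    {X : V | ∀ P ∈ I, value P X = 0}ᶜ = {X : V | ∃ g : G, rho g X₀ = X}

/-- A character of `SL_5 × GL_4` is rational when it is a regular function on this algebraic
group: a polynomial in the entries of `A` and `B`, divided by a power of `det B`. -/
def IsRationalCharacter (χ : G →* ℂˣ) : Prop :=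
  ∃ (Q : MvPolynomial ((Fin 5 × Fin 5) ⊕ (Fin 4 × Fin 4)) ℂ) (n : ℕ), ∀ g : G,
    (χ g : ℂ) = MvPolynomial.eval
        (Sum.elim (fun p => (g.1 : Matrix (Fin 5) (Fin 5) ℂ) p.1 p.2)
          (fun p => (g.2 : Matrix (Fin 4) (Fin 4) ℂ) p.1 p.2)) Q
      / (g.2 : Matrix (Fin 4) (Fin 4) ℂ).det ^ n

/-- The nonzero polynomial `P` is a relative invariant of `(SL_5 × GL_4, Λ₂ ⊗ Λ₁, Alt_5^{⊕4})`
that corresponds to the rational character `χ`. -/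
def IsRelativeInvariant (P : MvPolynomial Coord ℂ) (χ : G →* ℂˣ) : Prop :=
  P ≠ 0 ∧ IsRationalCharacter χ ∧ ∀ (g : G) (X : V), value P (rho g X) = (χ g : ℂ) * value P X

/-- The character `(A, B) ↦ (det B)^m`. -/
noncomputable def detPow (m : ℕ) : G →* ℂˣ :=
  (GeneralLinearGroup.det.comp (MonoidHom.snd _ _)) ^ m

end QuinaryAlt

/-! The brackets are `SL_5`-invariant, because `beta` is equivariant with values in the dual of `ℂ⁵`
(`beta_conj`). Under `GL_4` the matrix `Φ` transforms by `Φ(mix B X) = (det B)² B Φ(X) ᵗB`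
(`phiMat_mix`). This is checked on diagonal matrices, where it is a count of weights, and on
transvections. Permutations reduce the transvections to a single shear, for which multilinearity and
the linear relations between brackets turn the claim into a polynomial identity. Taking
determinants, `f = det Φ` has the character `(det B)^(8+2)`.

An explicit family of quadruples (`phiMat_family`) attains every rank under `Φ`. Complex symmetric
matrices are classified up to congruence by rank, and the factor `(det B)²` can be absorbed by a
scalar, so `Φ` is surjective.

For the generic member `base` of the family the infinitesimal action is onto, hence its orbit is
open and a polynomial is determined by its values there. The decisive statement is
`exists_pow_eq_mul_discPoly_pow`: a polynomial `P` without zeros on the orbit satisfies `P ^ 40 = c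
f ^ k` with `c ≠ 0`. Indeed, along a one-parameter group of transvections `P` is a zero-free
polynomial in one variable, so it is constant. Thus `P` is invariant under `SL_5 × SL_4`, and on the
line of multiples of `base` it is a monomial.

Three consequences finish the proof. Applied to the determinant of the infinitesimal action, it
shows that all orbits in `f ≠ 0` are open; as a complex line minus finitely many points is
connected, there is only one such orbit. Applied to the factors of `f`, it shows that every nonunit
factor vanishes wherever `f` does; but `f` has a simple zero along a line in the family, so `f` is
irreducible. Applied to an irreducible relative invariant `P`, it gives `f ∣ P`. -/

set_option linter.unusedSimpArgs false

namespace QuinaryAlt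

open Matrix

/-! ### Multilinearity of the brackets -/

theorem beta_comm (X Y : Alt 5) : beta X Y = beta Y X := by
  funext a
  simp only [beta, add_comm (del a X)]
  ring

theorem beta_add_left (X Y Z : Alt 5) : beta (X + Y) Z = beta X Z + beta Y Z := by
  funext a
  simp only [Pi.add_apply]
  fin_cases a <;> simp [beta_zero, beta_one, beta_two, beta_three, beta_four] <;> ring

theorem beta_smul_left (c : ℂ) (X Y : Alt 5) : beta (c • X) Y = c • beta X Y := by
  funext a
  simp only [Pi.smul_apply]
  fin_cases a <;> simp [beta_zero, beta_one, beta_two, beta_three, beta_four] <;> ring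

theorem beta_add_right (X Y Z : Alt 5) : beta X (Y + Z) = beta X Y + beta X Z := by
  rw [beta_comm, beta_add_left, beta_comm Y, beta_comm Z]

theorem beta_smul_right (c : ℂ) (X Y : Alt 5) : beta X (c • Y) = c • beta X Y := by
  rw [beta_comm, beta_smul_left, beta_comm Y]

/-- The five-linear form underlying the brackets. -/
def bracket (x y z u v : Alt 5) : ℂ := beta x y ⬝ᵥ (z.1 *ᵥ beta u v)

section Bracket

variable (a b x y z u v : Alt 5) (c : ℂ)

theorem bracket_add_smul₁ :
    bracket (a + c • b) y z u v = bracket a y z u v + c * bracket b y z u v := by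
  simp [bracket, beta_add_left, beta_smul_left]

theorem bracket_add_smul₂ :
    bracket x (a + c • b) z u v = bracket x a z u v + c * bracket x b z u v := by
  simp [bracket, beta_add_right, beta_smul_right]

theorem bracket_add_smul₃ :
    bracket x y (a + c • b) u v = bracket x y a u v + c * bracket x y b u v := by
  simp [bracket, add_mulVec, smul_mulVec]

theorem bracket_add_smul₄ :
    bracket x y z (a + c • b) v = bracket x y z a v + c * bracket x y z b v := by
  simp [bracket, beta_add_left, beta_smul_left, mulVec_add, mulVec_smul]

theorem bracket_add_smul₅ :
    bracket x y z u (a + c • b) = bracket x y z u a + c * bracket x y z u b := by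
  simp [bracket, beta_add_right, beta_smul_right, mulVec_add, mulVec_smul]

end Bracket

theorem br_eq_bracket (X : V) (i j k l m : Fin 4) :
    br X i j k l m = bracket (X i) (X j) (X k) (X l) (X m) := rfl

theorem br_permute (τ : Equiv.Perm (Fin 4)) (X : V) (i j k l m : Fin 4) :
    br (permute τ X) i j k l m = br X (τ i) (τ j) (τ k) (τ l) (τ m) := rfl

theorem br_smul (t : Fin 4 → ℂ) (X : V) (i j k l m : Fin 4) :
    br (fun n => t n • X n) i j k l m = t i * t j * t k * t l * t m * br X i j k l m := by
  simp only [br, beta_smul_left, beta_smul_right, SetLike.val_smul, smul_mulVec, mulVec_smul,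
    smul_dotProduct, dotProduct_smul, smul_eq_mul]
  ring

/-! ### Normal form of the brackets -/

/-- The inequalities in the sorting lemmas orient the symmetries: `simp` can decide them for
numerals, and rewriting stops once the indices are in order. -/
theorem br_sort_left (X : V) {i j : Fin 4} (k l m : Fin 4) (_h : j < i) :
    br X i j k l m = br X j i k l m := br_symm_left X i j k l m

theorem br_sort_right (X : V) (i j k : Fin 4) {l m : Fin 4} (_h : m < l) :
    br X i j k l m = br X i j k m l := br_symm_right X i j k l m

theorem br_sort_fst (X : V) {i l : Fin 4} (j k m : Fin 4) (_h : l < i) :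
    br X i j k l m = -br X l m k i j := br_anti X i j k l m

theorem br_sort_snd (X : V) (i : Fin 4) {j m : Fin 4} (k : Fin 4) (_h : m < j) :
    br X i j k i m = -br X i m k i j := br_anti X i j k i m

theorem br_self (X : V) (i j k : Fin 4) : br X i j k i j = 0 := by
  linear_combination (1 / 2) * br_anti X i j k i j

/-- This and the following relations come from `br_cyclic` and the symmetries. They eliminate sorted
brackets in favour of fewer ones, so that the identities for `phi` become polynomial identities in
the remaining brackets. -/
theorem br_00211 (X : V) : br X 0 0 2 1 1 = -2 * br X 0 0 1 1 2 := by
  grind [br_symm_left, br_symm_right, br_anti, br_cyclic]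

theorem br_00311 (X : V) : br X 0 0 3 1 1 = -2 * br X 0 0 1 1 3 := by
  grind [br_symm_left, br_symm_right, br_anti, br_cyclic]

theorem br_00322 (X : V) : br X 0 0 3 2 2 = -2 * br X 0 0 2 2 3 := by
  grind [br_symm_left, br_symm_right, br_anti, br_cyclic]

theorem br_01002 (X : V) : br X 0 1 0 0 2 = -1 / 2 * br X 0 0 1 0 2 := by
  grind [br_symm_left, br_symm_right, br_anti, br_cyclic]

theorem br_01003 (X : V) : br X 0 1 0 0 3 = -1 / 2 * br X 0 0 1 0 3 := by
  grind [br_symm_left, br_symm_right, br_anti, br_cyclic]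

theorem br_01012 (X : V) : br X 0 1 0 1 2 = -1 / 2 * br X 0 0 1 1 2 := by
  grind [br_symm_left, br_symm_right, br_anti, br_cyclic]

theorem br_01013 (X : V) : br X 0 1 0 1 3 = -1 / 2 * br X 0 0 1 1 3 := by
  grind [br_symm_left, br_symm_right, br_anti, br_cyclic]

theorem br_01102 (X : V) : br X 0 1 1 0 2 = 1 / 2 * br X 0 0 1 1 2 := by
  grind [br_symm_left, br_symm_right, br_anti, br_cyclic]

theorem br_01103 (X : V) : br X 0 1 1 0 3 = 1 / 2 * br X 0 0 1 1 3 := by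
  grind [br_symm_left, br_symm_right, br_anti, br_cyclic]

theorem br_01211 (X : V) : br X 0 1 2 1 1 = -2 * br X 0 1 1 1 2 := by
  grind [br_symm_left, br_symm_right, br_anti, br_cyclic]

theorem br_01302 (X : V) : br X 0 1 3 0 2 = -br X 0 1 2 0 3 + 1 / 2 * br X 0 0 1 2 3 := by
  grind [br_symm_left, br_symm_right, br_anti, br_cyclic]

theorem br_01311 (X : V) : br X 0 1 3 1 1 = -2 * br X 0 1 1 1 3 := by
  grind [br_symm_left, br_symm_right, br_anti, br_cyclic]

theorem br_01312 (X : V) : br X 0 1 3 1 2 = -br X 0 1 2 1 3 - br X 0 1 1 2 3 := by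
  grind [br_symm_left, br_symm_right, br_anti, br_cyclic]

theorem br_01322 (X : V) : br X 0 1 3 2 2 = -2 * br X 0 1 2 2 3 := by
  grind [br_symm_left, br_symm_right, br_anti, br_cyclic]

theorem br_02003 (X : V) : br X 0 2 0 0 3 = -1 / 2 * br X 0 0 2 0 3 := by
  grind [br_symm_left, br_symm_right, br_anti, br_cyclic]

theorem br_02011 (X : V) : br X 0 2 0 1 1 = br X 0 0 1 1 2 := by
  grind [br_symm_left, br_symm_right, br_anti, br_cyclic]

theorem br_02013 (X : V) : br X 0 2 0 1 3 = -1 / 2 * br X 0 0 2 1 3 := by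
  grind [br_symm_left, br_symm_right, br_anti, br_cyclic]

theorem br_02103 (X : V) : br X 0 2 1 0 3 = 1 / 2 * br X 0 0 2 1 3 - br X 0 1 2 0 3 + 1 / 2 * br
    X 0 0 1 2 3 := by
  grind [br_symm_left, br_symm_right, br_anti, br_cyclic]

theorem br_02111 (X : V) : br X 0 2 1 1 1 = 0 := by
  grind [br_symm_left, br_symm_right, br_anti, br_cyclic]

theorem br_02212 (X : V) : br X 0 2 2 1 2 = -1 / 2 * br X 0 2 1 2 2 := by
  grind [br_symm_left, br_symm_right, br_anti, br_cyclic]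

theorem br_02311 (X : V) : br X 0 2 3 1 1 = -2 * br X 0 2 1 1 3 := by
  grind [br_symm_left, br_symm_right, br_anti, br_cyclic]

theorem br_02312 (X : V) : br X 0 2 3 1 2 = -br X 0 2 2 1 3 - br X 0 2 1 2 3 := by
  grind [br_symm_left, br_symm_right, br_anti, br_cyclic]

theorem br_03011 (X : V) : br X 0 3 0 1 1 = br X 0 0 1 1 3 := by
  grind [br_symm_left, br_symm_right, br_anti, br_cyclic]

theorem br_03012 (X : V) : br X 0 3 0 1 2 = 1 / 2 * br X 0 0 2 1 3 + 1 / 2 * br X 0 0 1 2 3 := by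
  grind [br_symm_left, br_symm_right, br_anti, br_cyclic]

theorem br_03111 (X : V) : br X 0 3 1 1 1 = 0 := by
  grind [br_symm_left, br_symm_right, br_anti, br_cyclic]

theorem br_03112 (X : V) : br X 0 3 1 1 2 = br X 0 1 1 2 3 - br X 0 2 1 1 3 := by
  grind [br_symm_left, br_symm_right, br_anti, br_cyclic]

theorem br_03211 (X : V) : br X 0 3 2 1 1 = -2 * br X 0 1 1 2 3 + 2 * br X 0 2 1 1 3 := by
  grind [br_symm_left, br_symm_right, br_anti, br_cyclic]

theorem br_03213 (X : V) : br X 0 3 2 1 3 = -br X 0 3 1 2 3 + 1 / 2 * br X 0 2 1 3 3 + 1 / 2 * br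
    X 0 1 2 3 3 := by
  grind [br_symm_left, br_symm_right, br_anti, br_cyclic]

theorem br_03313 (X : V) : br X 0 3 3 1 3 = -1 / 2 * br X 0 3 1 3 3 := by
  grind [br_symm_left, br_symm_right, br_anti, br_cyclic]

theorem br_03323 (X : V) : br X 0 3 3 2 3 = -1 / 2 * br X 0 3 2 3 3 := by
  grind [br_symm_left, br_symm_right, br_anti, br_cyclic]

theorem br_11012 (X : V) : br X 1 1 0 1 2 = -2 * br X 0 1 1 1 2 := by
  grind [br_symm_left, br_symm_right, br_anti, br_cyclic]

theorem br_11013 (X : V) : br X 1 1 0 1 3 = -2 * br X 0 1 1 1 3 := by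
  grind [br_symm_left, br_symm_right, br_anti, br_cyclic]

theorem br_11022 (X : V) : br X 1 1 0 2 2 = -2 * br X 0 1 1 2 2 := by
  grind [br_symm_left, br_symm_right, br_anti, br_cyclic]

theorem br_11033 (X : V) : br X 1 1 0 3 3 = -2 * br X 0 1 1 3 3 := by
  grind [br_symm_left, br_symm_right, br_anti, br_cyclic]

theorem br_11112 (X : V) : br X 1 1 1 1 2 = 0 := by
  grind [br_symm_left, br_symm_right, br_anti, br_cyclic]

theorem br_11113 (X : V) : br X 1 1 1 1 3 = 0 := by
  grind [br_symm_left, br_symm_right, br_anti, br_cyclic]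

theorem br_11122 (X : V) : br X 1 1 1 2 2 = 0 := by
  grind [br_symm_left, br_symm_right, br_anti, br_cyclic]

theorem br_11133 (X : V) : br X 1 1 1 3 3 = 0 := by
  grind [br_symm_left, br_symm_right, br_anti, br_cyclic]

theorem br_11312 (X : V) : br X 1 1 3 1 2 = -br X 1 1 2 1 3 := by
  grind [br_symm_left, br_symm_right, br_anti, br_cyclic]

theorem br_11322 (X : V) : br X 1 1 3 2 2 = -2 * br X 1 1 2 2 3 := by
  grind [br_symm_left, br_symm_right, br_anti, br_cyclic]

theorem br_12013 (X : V) : br X 1 2 0 1 3 = -br X 0 2 1 1 3 - br X 0 1 2 1 3 := by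
  grind [br_symm_left, br_symm_right, br_anti, br_cyclic]

theorem br_12023 (X : V) : br X 1 2 0 2 3 = -br X 0 2 1 2 3 - br X 0 1 2 2 3 := by
  grind [br_symm_left, br_symm_right, br_anti, br_cyclic]

theorem br_12113 (X : V) : br X 1 2 1 1 3 = -1 / 2 * br X 1 1 2 1 3 := by
  grind [br_symm_left, br_symm_right, br_anti, br_cyclic]

theorem br_12123 (X : V) : br X 1 2 1 2 3 = -1 / 2 * br X 1 1 2 2 3 := by
  grind [br_symm_left, br_symm_right, br_anti, br_cyclic]

theorem br_13023 (X : V) : br X 1 3 0 2 3 = -br X 0 3 1 2 3 + 1 / 2 * br X 0 1 2 3 3 := by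
  grind [br_symm_left, br_symm_right, br_anti, br_cyclic]

theorem br_13123 (X : V) : br X 1 3 1 2 3 = 1 / 4 * br X 1 1 2 3 3 := by
  grind [br_symm_left, br_symm_right, br_anti, br_cyclic]

theorem br_13323 (X : V) : br X 1 3 3 2 3 = -1 / 2 * br X 1 3 2 3 3 := by
  grind [br_symm_left, br_symm_right, br_anti, br_cyclic]

theorem br_22033 (X : V) : br X 2 2 0 3 3 = -2 * br X 0 2 2 3 3 := by
  grind [br_symm_left, br_symm_right, br_anti, br_cyclic]

theorem br_22133 (X : V) : br X 2 2 1 3 3 = -2 * br X 1 2 2 3 3 := by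
  grind [br_symm_left, br_symm_right, br_anti, br_cyclic]

/-- Add `c` times the second component to the first. -/
def shear (c : ℂ) (X : V) : V := fun i => if i = 0 then X 0 + c • X 1 else X i

theorem shear_zero (c : ℂ) (X : V) : shear c X 0 = X 0 + c • X 1 := rfl

theorem shear_one (c : ℂ) (X : V) : shear c X 1 = X 1 := rfl

theorem shear_two (c : ℂ) (X : V) : shear c X 2 = X 2 := rfl

theorem shear_three (c : ℂ) (X : V) : shear c X 3 = X 3 := rfl

-- Expand by multilinearity, reduce every bracket to normal form, and compare polynomials in the
-- brackets. The entries with index `3` that are missing here follow from those with index `2` by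
-- exchanging the last two positions.
set_option maxHeartbeats 4000000 in
theorem phi_shear_aux (c : ℂ) (X : V) :
    phi 0 0 (shear c X) = phi 0 0 X + 2 * c * phi 0 1 X + c ^ 2 * phi 1 1 X ∧
    phi 0 1 (shear c X) = phi 0 1 X + c * phi 1 1 X ∧
    phi 0 2 (shear c X) = phi 0 2 X + c * phi 1 2 X ∧
    phi 1 1 (shear c X) = phi 1 1 X ∧
    phi 1 2 (shear c X) = phi 1 2 X ∧
    phi 2 2 (shear c X) = phi 2 2 X ∧
    phi 2 3 (shear c X) = phi 2 3 X := by
  have e : ∀ i j k l m, bracket (X i) (X j) (X k) (X l) (X m) = br X i j k l m :=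
    fun _ _ _ _ _ => rfl
  refine ⟨?_, ?_, ?_, ?_, ?_, ?_, ?_⟩
  all_goals
    simp (decide := true) only [phi, phi11, phi12, br_permute, carry, Equiv.swap_apply_def,
      Equiv.Perm.mul_apply, if_true, if_false, br_eq_bracket (shear c X), shear_zero, shear_one,
      shear_two, shear_three, bracket_add_smul₁, bracket_add_smul₂, bracket_add_smul₃,
      bracket_add_smul₄, bracket_add_smul₅, e]
    simp (decide := true) only [br_sort_left, br_sort_right, br_sort_fst, br_sort_snd, br_self]
    simp only [br_00211, br_00311, br_00322, br_01002, br_01003, br_01012, br_01013, br_01102,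
    br_01103, br_01211, br_01302, br_01311, br_01312, br_01322, br_02003, br_02011,
    br_02013, br_02103, br_02111, br_02212, br_02311, br_02312, br_03011, br_03012,
    br_03111, br_03112, br_03211, br_03213, br_03313, br_03323, br_11012, br_11013,
    br_11022, br_11033, br_11112, br_11113, br_11122, br_11133, br_11312, br_11322,
    br_12013, br_12023, br_12113, br_12123, br_13023, br_13123, br_13323, br_22033,
    br_22133]
    ring

/-! ### Equivariance of `Φ` under `GL_4` -/

theorem permute_permute (σ τ : Equiv.Perm (Fin 4)) (X : V) :
    permute σ (permute τ X) = permute (τ * σ) X := rfl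

theorem phi11_swap_one_two (X : V) : phi11 (permute (Equiv.swap 1 2) X) = phi11 X := by
  simp (decide := true) only [phi11, br_permute, Equiv.swap_apply_def, if_true, if_false]
  grind [br_symm_left, br_symm_right, br_anti, br_cyclic]

theorem phi11_swap_two_three (X : V) : phi11 (permute (Equiv.swap 2 3) X) = phi11 X := by
  simp (decide := true) only [phi11, br_permute, Equiv.swap_apply_def, if_true, if_false]
  grind [br_symm_left, br_symm_right, br_anti, br_cyclic]

theorem perm_fixing_zero : ∀ τ : Equiv.Perm (Fin 4), τ 0 = 0 →
    τ = 1 ∨ τ = Equiv.swap 1 2 ∨ τ = Equiv.swap 2 3 ∨ τ = Equiv.swap 1 2 * Equiv.swap 2 3 ∨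
    τ = Equiv.swap 2 3 * Equiv.swap 1 2 ∨
    τ = Equiv.swap 1 2 * (Equiv.swap 2 3 * Equiv.swap 1 2) := by
  decide

theorem phi11_permute_of_fixing {τ : Equiv.Perm (Fin 4)} (h : τ 0 = 0) (X : V) :
    phi11 (permute τ X) = phi11 X := by
  rcases perm_fixing_zero τ h with h | h | h | h | h | h <;> rw [h]
  · rfl
  · exact phi11_swap_one_two X
  · exact phi11_swap_two_three X
  · rw [← permute_permute, phi11_swap_two_three, phi11_swap_one_two]
  · rw [← permute_permute, phi11_swap_one_two, phi11_swap_two_three]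
  · rw [← permute_permute, ← permute_permute, phi11_swap_one_two, phi11_swap_two_three,
      phi11_swap_one_two]

/-- Off the diagonal this is the independence of `phi12` from the choice of permutation. On the
diagonal it is the invariance of `phi11` under the stabilizer of the first position, a copy of `S₃`.
-/
theorem phi_permute (τ : Equiv.Perm (Fin 4)) (s t : Fin 4) (X : V) :
    phi s t (permute τ X) = phi (τ s) (τ t) X := by
  by_cases h : s = t
  · subst h
    rw [phi, if_pos rfl, phi, if_pos rfl, permute_permute]
    have : τ * Equiv.swap 0 s = Equiv.swap 0 (τ s) * (Equiv.swap 0 (τ s) * (τ * Equiv.swap 0 s))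
        := by
      rw [← mul_assoc, Equiv.swap_mul_self, one_mul]
    rw [this, ← permute_permute, phi11_permute_of_fixing]
    simp
  · have := phi_eq_of_perm (τ * carry s t) X
    rw [Equiv.Perm.mul_apply, Equiv.Perm.mul_apply, carry_zero s t h, carry_one s t h] at this
    rw [this, phi, if_neg h, permute_permute]

theorem phi_shear (c : ℂ) (X : V) (s t : Fin 4) :
    phi s t (shear c X) = phi s t X + (if s = 0 then c * phi 1 t X else 0)
      + (if t = 0 then c * phi s 1 X else 0) + if s = 0 ∧ t = 0 then c ^ 2 * phi 1 1 X else 0 := by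
  obtain ⟨h00, h01, h02, h11, h12, h22, h23⟩ := phi_shear_aux c X
  -- The shear involves only positions `0` and `1`, so it commutes with this swap.
  have hs : permute (Equiv.swap 2 3) (shear c X) = shear c (permute (Equiv.swap 2 3) X) := by
    funext i
    fin_cases i <;> rfl
  obtain ⟨-, -, h03, -, h13, h33, -⟩ := phi_shear_aux c (permute (Equiv.swap 2 3) X)
  rw [← hs] at h03 h13 h33
  simp (decide := true) only [phi_permute, Equiv.swap_apply_def, if_true, if_false] at h03 h13 h33
  fin_cases s <;> fin_cases t <;> simp (decide := true) only [Fin.zero_eta, Fin.mk_one,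
      Fin.reduceFinMk, if_true, if_false,
    h00, h01, h02, h11, h12, h22, h23, h03, h13, h33, phi_symm 1 0, phi_symm 2 0, phi_symm 3 0,
        phi_symm 2 1, phi_symm 3 1, phi_symm 3 2] <;> ring

/-- Every term of `phi11` has multidegree `(4, 2, 2, 2)` in the four components; every term of
`phi12` has `(3, 3, 2, 2)`. -/
theorem phi11_smul (t : Fin 4 → ℂ) (X : V) :
    phi11 (fun n => t n • X n) = (∏ n, t n) ^ 2 * (t 0 * t 0) * phi11 X := by
  simp only [phi11, br_smul, Fin.prod_univ_four]
  ring

theorem phi12_smul (t : Fin 4 → ℂ) (X : V) :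
    phi12 (fun n => t n • X n) = (∏ n, t n) ^ 2 * (t 0 * t 1) * phi12 X := by
  simp only [phi12, br_smul, Fin.prod_univ_four]
  ring

theorem phi_smul (t : Fin 4 → ℂ) (X : V) (r s : Fin 4) :
    phi r s (fun n => t n • X n) = (∏ n, t n) ^ 2 * (t r * t s) * phi r s X := by
  have e (τ : Equiv.Perm (Fin 4)) : permute τ (fun n => t n • X n) =
      fun n => (t ∘ τ) n • permute τ X n := rfl
  by_cases h : r = s
  · subst h
    rw [phi, if_pos rfl, phi, if_pos rfl, e, phi11_smul]
    simp only [Function.comp_apply, Equiv.prod_comp, Equiv.swap_apply_left]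
  · rw [phi, if_neg h, phi, if_neg h, e, phi12_smul]
    simp only [Function.comp_apply, Equiv.prod_comp, carry_zero r s h, carry_one r s h]

/-- The action of a `4 × 4` matrix on quadruples. -/
def mix (B : Matrix (Fin 4) (Fin 4) ℂ) (X : V) : V := fun i => ∑ j, B i j • X j

theorem mix_mul (B C : Matrix (Fin 4) (Fin 4) ℂ) (X : V) : mix (B * C) X = mix B (mix C X) := by
  funext i
  simp only [mix, Matrix.mul_apply, Finset.sum_smul, Finset.smul_sum, smul_smul]
  exact Finset.sum_comm

theorem mix_one (X : V) : mix 1 X = X := by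
  funext i
  simp [mix, Matrix.one_apply]

theorem mix_diagonal (t : Fin 4 → ℂ) (X : V) : mix (diagonal t) X = fun n => t n • X n := by
  funext i
  simp [mix, diagonal_apply]

/-- The shear is the transvection for the positions `0, 1`; conjugation by `carry p q` moves these
to `p, q`. -/
theorem mix_transvection {p q : Fin 4} (h : p ≠ q) (c : ℂ) (X : V) :
    mix (transvection p q c) X = permute (carry p q)⁻¹ (shear c (permute (carry p q) X)) := by
  have h0 := carry_zero p q h
  have h1 := carry_one p q h
  funext i
  have hm : mix (transvection p q c) X i = X i + if i = p then c • X q else 0 := by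
    simp [mix, transvection, add_smul, Finset.sum_add_distrib, Matrix.one_apply, single_apply,
        ite_and, eq_comm]
  rw [hm]
  have hi : (carry p q)⁻¹ i = 0 ↔ i = p := by
    rw [Equiv.Perm.inv_eq_iff_eq, h0]
  by_cases hp : i = p
  · subst hp
    simp [permute, shear, hi.2 rfl, h0, h1]
  · have hj : ¬(carry p q)⁻¹ i = 0 := fun hj => hp (hi.1 hj)
    have hc : carry p q ((carry p q)⁻¹ i) = i := Equiv.apply_symm_apply _ i
    simp only [permute, shear, if_neg hj, if_neg hp, hc, add_zero]

/-- The matrix `Φ(X)`. -/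
abbrev phiMat (X : V) : Matrix (Fin 4) (Fin 4) ℂ := (Phi X).1

theorem phiMat_apply (X : V) (s t : Fin 4) : phiMat X s t = phi s t X := rfl

/-- Both sides are compatible with products, so generators suffice: `phi_smul` treats diagonal
matrices, including singular ones, and `phi_shear` treats transvections. -/
theorem phiMat_mix (B : Matrix (Fin 4) (Fin 4) ℂ) :
    ∀ X : V, phiMat (mix B X) = B.det ^ 2 • (B * phiMat X * Bᵀ) := by
  induction B using diagonal_transvection_induction with
  | hdiag t ht =>
    intro X
    ext r s
    rw [phiMat_apply, mix_diagonal, phi_smul]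
    simp only [det_diagonal, diagonal_transpose, Matrix.smul_apply, mul_diagonal, diagonal_mul,
      phiMat_apply, smul_eq_mul]
    ring
  | htransvec τ =>
    obtain ⟨p, q, h, c⟩ := τ
    intro X
    have h0 := carry_zero p q h
    have h1 := carry_one p q h
    have hi (i : Fin 4) : (carry p q)⁻¹ i = 0 ↔ i = p := by
      rw [Equiv.Perm.inv_eq_iff_eq, h0]
    have hc (i : Fin 4) : carry p q ((carry p q)⁻¹ i) = i := Equiv.apply_symm_apply _ i
    ext r s
    simp only [TransvectionStruct.toMatrix, det_transvection_of_ne _ _ h, one_pow, one_smul]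
    rw [phiMat_apply, mix_transvection h, phi_permute, phi_shear]
    simp only [phi_permute, hi, h1, hc, transvection, transpose_add, transpose_one,
        Matrix.add_mul, Matrix.mul_add,
      Matrix.one_mul, Matrix.mul_one, transpose_single, Matrix.add_apply, phiMat_apply]
    by_cases hr : r = p
    · subst hr
      by_cases hs : s = r
      · subst hs
        simp [phiMat_apply]
        ring
      · simp [phiMat_apply, hs]
    · by_cases hs : s = p
      · subst hs
        simp [phiMat_apply, hr, mul_comm]
      · simp [hs, hr]
  | hmul B C hB hC =>
    intro X
    rw [mix_mul, hB, hC, det_mul, transpose_mul]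
    simp only [Matrix.mul_smul, Matrix.smul_mul, smul_smul, Matrix.mul_assoc, mul_pow]

/-! ### Generation of the special linear groups by transvections -/

section Generation

variable {n : Type*} [Fintype n] [DecidableEq n]

theorem transvection_mul_transvection_mul_transvection {i j : n} (h : i ≠ j) {t : ℂ} (ht : t ≠ 0) :
    transvection i j t * transvection j i (-t⁻¹) * transvection i j t =
      1 - single i i 1 - single j j 1 + single i j t - single j i t⁻¹ := by
  simp only [transvection, Matrix.mul_add, Matrix.add_mul, Matrix.mul_one, Matrix.one_mul,
    single_mul_single_same, single_mul_single_of_ne _ _ _ _ h.symm]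
  have h1 : t * -t⁻¹ = -1 := by field_simp
  have h2 : -t⁻¹ * t = -1 := by field_simp
  rw [h1, h2]
  ext a b
  simp only [Matrix.add_apply, Matrix.sub_apply, Matrix.zero_apply, single_apply]
  split_ifs <;> ring

/-- In the plane of `i, j` the triple product above is `w(t) = (0, t; -t⁻¹, 0)`, and `w(t) w(-1) =
diag(t, t⁻¹)`. -/
theorem diagonal_eq_transvections {i j : n} (h : i ≠ j) {t : ℂ} (ht : t ≠ 0) :
    diagonal (Function.update (Function.update 1 i t) j t⁻¹) =
      (transvection i j t * transvection j i (-t⁻¹) * transvection i j t) *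
        (transvection i j (-1) * transvection j i (-(-1)⁻¹) * transvection i j (-1)) := by
  rw [transvection_mul_transvection_mul_transvection h ht,
    transvection_mul_transvection_mul_transvection h (by norm_num : (-1 : ℂ) ≠ 0)]
  simp only [Matrix.mul_add, Matrix.add_mul, Matrix.mul_sub, Matrix.sub_mul, Matrix.mul_one,
    Matrix.one_mul, single_mul_single_same, single_mul_single_of_ne _ _ _ _ h,
    single_mul_single_of_ne _ _ _ _ h.symm]
  ext a b
  simp only [Matrix.add_apply, Matrix.sub_apply, Matrix.zero_apply, single_apply, diagonal_apply,
    Function.update_apply, Matrix.one_apply, Pi.one_apply]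
  by_cases ha : a = i
  · subst ha
    by_cases hb : b = a
    · subst hb; simp [h, h.symm]
    · simp [h.symm, Ne.symm hb]
  · by_cases ha' : a = j
    · subst ha'
      by_cases hb : b = a
      · subst hb; simp [h]
      · simp [h, Ne.symm hb]
    · simp [ha, ha', Ne.symm ha, Ne.symm ha']

/-- The matrices of determinant one are products of transvections. -/
theorem transvection_induction {p : Matrix n n ℂ → Prop} (one : p 1)
    (transvec : ∀ i j, i ≠ j → ∀ c, p (transvection i j c))
    (mul : ∀ A B, p A → p B → p (A * B)) (A : Matrix n n ℂ) (hA : A.det = 1) : p A := by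
  have hlist : ∀ L : List (TransvectionStruct n ℂ), p (L.map TransvectionStruct.toMatrix).prod := by
    intro L
    induction L with
    | nil => exact one
    | cons τ L ih => exact mul _ _ (transvec _ _ τ.hij _) ih
  obtain ⟨L, L', D, hD⟩ := Pivot.exists_list_transvec_mul_diagonal_mul_list_transvec A
  have hdet : ∏ k, D k = 1 := by
    rw [hD, det_mul, det_mul, TransvectionStruct.det_toMatrix_prod,
      TransvectionStruct.det_toMatrix_prod, det_diagonal, one_mul, mul_one] at hA
    exact hA
  rw [hD]
  refine mul _ _ (mul _ _ (hlist L) ?_) (hlist L')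
  rcases isEmpty_or_nonempty n with hn | ⟨⟨k₀⟩⟩
  · rwa [Subsingleton.elim (diagonal D) 1]
  have hne : ∀ k, D k ≠ 0 := fun k hk => by
    rw [Finset.prod_eq_zero (Finset.mem_univ k) hk] at hdet
    exact zero_ne_one hdet
  -- The diagonal entries are split off one at a time, each balanced by its inverse at `k₀`. Since
  -- the product of all entries is `1`, taking every index except `k₀` yields the given diagonal
  -- matrix.
  have key : ∀ s : Finset n, k₀ ∉ s →
      p (diagonal fun k => if k ∈ s then D k else if k = k₀ then (∏ l ∈ s, D l)⁻¹ else 1) := by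
    intro s
    induction s using Finset.induction_on with
    | empty => intro _; simpa using one
    | insert a s ha ih =>
      intro hk
      have hka : a ≠ k₀ := fun h => hk (by simp [h])
      have hks : k₀ ∉ s := fun h => hk (by simp [h])
      have := mul _ _ (diagonal_eq_transvections hka (hne a) ▸
        mul _ _ (mul _ _ (mul _ _ (transvec _ _ hka _) (transvec _ _ hka.symm _))
          (transvec _ _ hka _)) (mul _ _ (mul _ _ (transvec _ _ hka _) (transvec _ _ hka.symm _))
          (transvec _ _ hka _))) (ih hks)
      rw [diagonal_mul_diagonal] at this
      refine Eq.mp (congrArg (fun d : n → ℂ => p (diagonal d)) (funext fun k => ?_)) this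
      rw [Function.update_apply, Function.update_apply, Finset.prod_insert ha]
      by_cases h1 : k = k₀
      · subst h1
        simp [hks, hka.symm, mul_comm]
      · by_cases h2 : k = a
        · subst h2
          simp [h1, ha]
        · simp [h1, h2]
  refine Eq.mp (congrArg (fun d : n → ℂ => p (diagonal d)) (funext fun k => ?_))
    (key (Finset.univ.erase k₀) (by simp))
  by_cases h : k = k₀
  · subst h
    rw [← Finset.mul_prod_erase _ _ (Finset.mem_univ k)] at hdet
    simp [eq_inv_of_mul_eq_one_left hdet]
  · simp [h]

end Generation

/-! ### Invariance of the brackets under `SL_5` -/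

theorem conj_mul {n : ℕ} (A B : Matrix (Fin n) (Fin n) ℂ) (X : Alt n) :
    conj (A * B) X = conj A (conj B X) := by
  ext1
  simp [conj, transpose_mul, Matrix.mul_assoc]

theorem conj_one {n : ℕ} (X : Alt n) : conj 1 X = X := by
  ext1
  simp [conj]

theorem conj_coe {n : ℕ} (A : Matrix (Fin n) (Fin n) ℂ) (X : Alt n) :
    (conj A X).1 = A * X.1 * Aᵀ := rfl

theorem conj_transvection_apply {i j : Fin 5} (c : ℂ) (X : Alt 5) (a b : Fin 5) :
    (conj (transvection i j c) X).1 a b = X.1 a b + (if i = a then c * X.1 j b else 0)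
      + (if i = b then c * X.1 a j else 0) + if i = a ∧ i = b then c ^ 2 * X.1 j j else 0 := by
  rw [conj_coe]
  simp only [transvection, transpose_add, transpose_one, Matrix.add_mul, Matrix.mul_add,
      Matrix.one_mul, Matrix.mul_one, transpose_single, Matrix.add_apply]
  by_cases ha : i = a
  · subst ha
    by_cases hb : i = b
    · subst hb
      simp
      ring
    · simp [hb, mul_single_apply_of_ne _ _ _ _ _ (Ne.symm hb)]
  · have h1 (M : Matrix (Fin 5) (Fin 5) ℂ) (d : Fin 5) : (single i j c * M) a d = 0 :=
      single_mul_apply_of_ne _ _ _ _ _ (Ne.symm ha) _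
    by_cases hb : i = b
    · subst hb
      simp [ha, h1, mul_comm]
    · simp [ha, hb, h1, mul_single_apply_of_ne _ _ _ _ _ (Ne.symm hb)]

theorem alt_diag (X : Alt 5) (a : Fin 5) : X.1 a a = 0 := by
  linear_combination (1 / 2) * alt_apply X a a

theorem vecMul_transvection_apply (i j : Fin 5) (c : ℂ) (v : Fin 5 → ℂ) (a : Fin 5) :
    (v ᵥ* transvection i j c) a = v a + if j = a then v i * c else 0 := by
  simp [transvection, vecMul, dotProduct, single_apply, Matrix.one_apply, mul_add,
    Finset.sum_add_distrib, ite_and]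

-- `beta` takes values in `Λ⁴ ℂ⁵`, which for determinant one is the dual of `ℂ⁵`. On transvections
-- this is a direct computation.
set_option linter.unusedSimpArgs false in
set_option maxHeartbeats 8000000 in
theorem beta_conj_transvection {i j : Fin 5} (h : i ≠ j) (c : ℂ) (X Y : Alt 5) :
    beta (conj (transvection i j c) X) (conj (transvection i j c) Y) ᵥ* transvection i j c =
      beta X Y := by
  funext a
  rw [vecMul_transvection_apply]
  fin_cases i <;> fin_cases j <;> first | exact absurd rfl h | skip
  all_goals
    fin_cases a <;>
    · simp (decide := true) only [Fin.zero_eta, Fin.mk_one, Fin.reduceFinMk, beta_zero, beta_one,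
        beta_two, beta_three, beta_four, conj_transvection_apply, if_true, if_false, add_zero,
        alt_diag, alt_apply _ 1 0, alt_apply _ 2 0, alt_apply _ 3 0, alt_apply _ 4 0,
        alt_apply _ 2 1, alt_apply _ 3 1, alt_apply _ 4 1, alt_apply _ 3 2, alt_apply _ 4 2,
        alt_apply _ 4 3]
      try ring

theorem beta_conj (A : Matrix (Fin 5) (Fin 5) ℂ) (hA : A.det = 1) (X Y : Alt 5) :
    beta (conj A X) (conj A Y) ᵥ* A = beta X Y := by
  refine transvection_induction (p := fun A => ∀ X Y, beta (conj A X) (conj A Y) ᵥ* A = beta X Y)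
    (fun X Y => by simp [conj_one]) (fun i j h c X Y => beta_conj_transvection h c X Y)
    (fun A B hA hB X Y => ?_) A hA X Y
  rw [conj_mul, conj_mul, ← vecMul_vecMul, hA, hB]

theorem br_conj (A : Matrix (Fin 5) (Fin 5) ℂ) (hA : A.det = 1) (X : V) (i j k l m : Fin 4) :
    br (fun n => conj A (X n)) i j k l m = br X i j k l m := by
  simp only [br]
  rw [← beta_conj A hA (X i), ← beta_conj A hA (X l), conj_coe, ← mulVec_mulVec, ← mulVec_mulVec,
    mulVec_transpose, ← dotProduct_mulVec]

theorem phi_conj (A : Matrix (Fin 5) (Fin 5) ℂ) (hA : A.det = 1) (X : V) (s t : Fin 4) :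
    phi s t (fun n => conj A (X n)) = phi s t X := by
  have e (τ : Equiv.Perm (Fin 4)) : permute τ (fun n => conj A (X n)) =
      fun n => conj A (permute τ X n) := rfl
  simp only [phi, phi11, phi12, e, br_conj A hA]

/-! ### The determinant of `Φ` and its equivariance -/

theorem rho_apply (g : G) (X : V) : rho g X =
    mix (g.2 : Matrix (Fin 4) (Fin 4) ℂ) fun n => conj (g.1 : Matrix (Fin 5) (Fin 5) ℂ) (X n) := rfl

theorem phiMat_rho (g : G) (X : V) : phiMat (rho g X) =
    (g.2 : Matrix (Fin 4) (Fin 4) ℂ).det ^ 2 •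
      ((g.2 : Matrix (Fin 4) (Fin 4) ℂ) * phiMat X * (g.2 : Matrix (Fin 4) (Fin 4) ℂ)ᵀ) := by
  rw [rho_apply, phiMat_mix]
  have : phiMat (fun n => conj (g.1 : Matrix (Fin 5) (Fin 5) ℂ) (X n)) = phiMat X := by
    ext s t
    exact phi_conj _ g.1.2 X s t
  rw [this]

/-- The function `X ↦ det Φ(X)`. -/
def disc (X : V) : ℂ := (phiMat X).det

theorem disc_rho (g : G) (X : V) :
    disc (rho g X) = (g.2 : Matrix (Fin 4) (Fin 4) ℂ).det ^ 10 * disc X := by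
  rw [disc, phiMat_rho, det_smul, det_mul, det_mul, det_transpose, disc, Fintype.card_fin]
  ring

/-! ### A family of quadruples with diagonal-like values of `Φ` -/

/-- A three-parameter family of quadruples. -/
def family (s t u : ℂ) : V :=
  ![⟨!![0, 0, 0, 1, 0; 0, 0, 0, 0, s; 0, 0, 0, 0, 0; -1, 0, 0, 0, 0; 0, -s, 0, 0, 0], by
      change _ᵀ = -_
      ext i j; fin_cases i <;> fin_cases j <;> simp⟩,
    ⟨!![0, 0, 0, 0, t; 0, 0, 0, 1, 0; 0, 0, 0, 0, 0; 0, -1, 0, 0, 0; -t, 0, 0, 0, 0], by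
      change _ᵀ = -_
      ext i j; fin_cases i <;> fin_cases j <;> simp⟩,
    ⟨!![0, 0, 1, 0, 0; 0, 0, 0, 0, 0; -1, 0, 0, 0, 0; 0, 0, 0, 0, u; 0, 0, 0, -u, 0], by
      change _ᵀ = -_
      ext i j; fin_cases i <;> fin_cases j <;> simp⟩,
    ⟨!![0, 1, 0, 0, 0; -1, 0, 0, 0, 0; 0, 0, 0, 0, 1; 0, 0, 0, 0, 0; 0, 0, -1, 0, 0], by
      change _ᵀ = -_
      ext i j; fin_cases i <;> fin_cases j <;> simp⟩]

section Family

variable (s t u : ℂ)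

theorem family_zero : (family s t u 0).1 =
    !![0, 0, 0, 1, 0; 0, 0, 0, 0, s; 0, 0, 0, 0, 0; -1, 0, 0, 0, 0; 0, -s, 0, 0, 0] := rfl

theorem family_one : (family s t u 1).1 =
    !![0, 0, 0, 0, t; 0, 0, 0, 1, 0; 0, 0, 0, 0, 0; 0, -1, 0, 0, 0; -t, 0, 0, 0, 0] := rfl

theorem family_two : (family s t u 2).1 =
    !![0, 0, 1, 0, 0; 0, 0, 0, 0, 0; -1, 0, 0, 0, 0; 0, 0, 0, 0, u; 0, 0, 0, -u, 0] := rfl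

theorem family_three : (family s t u 3).1 =
    !![0, 1, 0, 0, 0; -1, 0, 0, 0, 0; 0, 0, 0, 0, 1; 0, 0, 0, 0, 0; 0, 0, -1, 0, 0] := rfl

theorem beta_family :
    beta (family s t u 0) (family s t u 0) = ![0, 0, -2 * s, 0, 0] ∧
    beta (family s t u 0) (family s t u 1) = ![0, 0, 0, 0, 0] ∧
    beta (family s t u 0) (family s t u 2) = ![0, 0, 0, s, 0] ∧
    beta (family s t u 0) (family s t u 3) = ![0, 1, 0, 0, 0] ∧
    beta (family s t u 1) (family s t u 1) = ![0, 0, 2 * t, 0, 0] ∧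
    beta (family s t u 1) (family s t u 2) = ![0, 0, 0, 0, -1] ∧
    beta (family s t u 1) (family s t u 3) = ![-1, 0, 0, 0, 0] ∧
    beta (family s t u 2) (family s t u 2) = ![0, -2 * u, 0, 0, 0] ∧
    beta (family s t u 2) (family s t u 3) = ![0, 0, u, 0, 0] ∧
    beta (family s t u 3) (family s t u 3) = ![0, 0, 0, -2, 0] := by
  refine ⟨?_, ?_, ?_, ?_, ?_, ?_, ?_, ?_, ?_, ?_⟩
  all_goals
    funext a
    fin_cases a <;> simp [beta_zero, beta_one, beta_two, beta_three, beta_four, family_zero,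
      family_one, family_two, family_three] <;> ring

theorem vecFive_dotProduct_mulVec (M : Matrix (Fin 5) (Fin 5) ℂ) (a b c d e a' b' c' d' e' : ℂ) :
    ![a, b, c, d, e] ⬝ᵥ (M *ᵥ ![a', b', c', d', e']) =
      a * (M 0 0 * a' + M 0 1 * b' + M 0 2 * c' + M 0 3 * d' + M 0 4 * e')
      + b * (M 1 0 * a' + M 1 1 * b' + M 1 2 * c' + M 1 3 * d' + M 1 4 * e')
      + c * (M 2 0 * a' + M 2 1 * b' + M 2 2 * c' + M 2 3 * d' + M 2 4 * e')
      + d * (M 3 0 * a' + M 3 1 * b' + M 3 2 * c' + M 3 3 * d' + M 3 4 * e')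
      + e * (M 4 0 * a' + M 4 1 * b' + M 4 2 * c' + M 4 3 * d' + M 4 4 * e') := by
  simp [dotProduct, mulVec, Fin.sum_univ_five]

set_option maxHeartbeats 8000000 in
theorem phi_family :
    phi 0 0 (family s t u) = -288 * s ^ 2 ∧ phi 0 1 (family s t u) = 0 ∧
    phi 0 2 (family s t u) = 0 ∧ phi 0 3 (family s t u) = 0 ∧
    phi 1 1 (family s t u) = -480 * s * t ∧ phi 1 2 (family s t u) = 0 ∧
    phi 1 3 (family s t u) = 0 ∧ phi 2 2 (family s t u) = 0 ∧
    phi 2 3 (family s t u) = -720 * s * u ∧ phi 3 3 (family s t u) = 0 := by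
  obtain ⟨b00, b01, b02, b03, b11, b12, b13, b22, b23, b33⟩ := beta_family s t u
  refine ⟨?_, ?_, ?_, ?_, ?_, ?_, ?_, ?_, ?_, ?_⟩
  all_goals
    simp (decide := true) only [phi, phi11, phi12, br_permute, carry, Equiv.swap_apply_def,
      Equiv.Perm.mul_apply, if_true, if_false]
    simp (decide := true) only [br_sort_left, br_sort_right, br_sort_fst, br_sort_snd, br_self]
    simp only [br, b00, b01, b02, b03, b11, b12, b13, b22, b23, b33, vecFive_dotProduct_mulVec,
      family_zero, family_one, family_two, family_three]
    simp
    try ring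

/-- With parameters in `{0, 1}` this has rank `0` if `s = 0`, and `1 + t + 2u` if `s = 1`; so every
rank from `0` to `4` occurs. -/
theorem phiMat_family : phiMat (family s t u) =
    !![-288 * s ^ 2, 0, 0, 0; 0, -480 * s * t, 0, 0; 0, 0, 0, -720 * s * u;
      0, 0, -720 * s * u, 0] := by
  obtain ⟨h00, h01, h02, h03, h11, h12, h13, h22, h23, h33⟩ := phi_family s t u
  ext i j
  rw [phiMat_apply]
  fin_cases i <;> fin_cases j <;> simp [h00, h01, h02, h03, h11, h12, h13, h22, h23, h33,
    phi_symm 1 0, phi_symm 2 0, phi_symm 3 0, phi_symm 2 1, phi_symm 3 1, phi_symm 3 2]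

theorem disc_family : disc (family s t u) = -71663616000 * s ^ 5 * t * u ^ 2 := by
  rw [disc, phiMat_family]
  simp [det_succ_row_zero, Fin.sum_univ_succ, Fin.succAbove]
  ring

end Family

/-! ### Polynomial functions -/

theorem value_add (P Q : MvPolynomial Coord ℂ) (X : V) :
    value (P + Q) X = value P X + value Q X := map_add _ _ _

theorem value_mul (P Q : MvPolynomial Coord ℂ) (X : V) :
    value (P * Q) X = value P X * value Q X := map_mul _ _ _

theorem value_pow (P : MvPolynomial Coord ℂ) (n : ℕ) (X : V) :
    value (P ^ n) X = value P X ^ n := map_pow _ _ _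

theorem value_C (c : ℂ) (X : V) : value (MvPolynomial.C c) X = c := MvPolynomial.eval_C _

/-- The values of a homogeneous polynomial of degree `n`. -/
def IsForm (n : ℕ) (F : V → ℂ) : Prop :=
  ∃ P : MvPolynomial Coord ℂ, P.IsHomogeneous n ∧ ∀ X, value P X = F X

namespace IsForm

variable {m n : ℕ} {F H : V → ℂ}

theorem zero (n : ℕ) : IsForm n fun _ => 0 :=
  ⟨0, MvPolynomial.isHomogeneous_zero _ _ _, fun _ => map_zero _⟩

theorem add (hF : IsForm n F) (hH : IsForm n H) : IsForm n fun X => F X + H X := by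
  obtain ⟨P, hP, hP'⟩ := hF
  obtain ⟨Q, hQ, hQ'⟩ := hH
  exact ⟨P + Q, hP.add hQ, fun X => by rw [value_add, hP', hQ']⟩

theorem mul (hF : IsForm m F) (hH : IsForm n H) : IsForm (m + n) fun X => F X * H X := by
  obtain ⟨P, hP, hP'⟩ := hF
  obtain ⟨Q, hQ, hQ'⟩ := hH
  exact ⟨P * Q, hP.mul hQ, fun X => by rw [value_mul, hP', hQ']⟩

theorem const_mul (c : ℂ) (hF : IsForm n F) : IsForm n fun X => c * F X := by
  obtain ⟨P, hP, hP'⟩ := hF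
  refine ⟨MvPolynomial.C c * P, ?_, fun X => by rw [value_mul, value_C, hP']⟩
  simpa using (MvPolynomial.isHomogeneous_C Coord c).mul hP

theorem neg (hF : IsForm n F) : IsForm n fun X => -F X := by
  simpa using hF.const_mul (-1)

theorem sub (hF : IsForm n F) (hH : IsForm n H) : IsForm n fun X => F X - H X := by
  simpa [sub_eq_add_neg] using hF.add hH.neg

theorem pow_two (hF : IsForm n F) : IsForm (n + n) fun X => F X ^ 2 := by
  simpa [sq] using hF.mul hF

theorem sum {ι : Type*} (s : Finset ι) {F : ι → V → ℂ} (hF : ∀ i ∈ s, IsForm n (F i)) :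
    IsForm n fun X => ∑ i ∈ s, F i X := by
  classical
  induction s using Finset.induction_on with
  | empty => simpa using zero n
  | insert a s ha ih =>
    simp only [Finset.sum_insert ha]
    exact (hF a (by simp)).add (ih fun i hi => hF i (by simp [hi]))

theorem entry (k : Fin 4) (a b : Fin 5) : IsForm 1 fun X => (X k).1 a b := by
  rcases lt_trichotomy a b with h | h | h
  · exact ⟨MvPolynomial.X (k, ⟨(a, b), h⟩), MvPolynomial.isHomogeneous_X _ _,
      fun X => MvPolynomial.eval_X _⟩
  · subst h
    simpa only [alt_diag] using zero 1
  · have : IsForm 1 fun X => (X k).1 b a :=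
      ⟨MvPolynomial.X (k, ⟨(b, a), h⟩), MvPolynomial.isHomogeneous_X _ _,
        fun X => MvPolynomial.eval_X _⟩
    simpa only [alt_apply _ a b] using this.neg

theorem beta (i j : Fin 4) (a : Fin 5) : IsForm 2 fun X => beta (X i) (X j) a := by
  have e (k l : Fin 4) (p q r s : Fin 5) : IsForm 2 fun X => (X k).1 p q * (X l).1 r s :=
    (entry k p q).mul (entry l r s)
  fin_cases a
  · simp only [Fin.zero_eta, beta_zero]
    exact (((((e _ _ _ _ _ _).sub (e _ _ _ _ _ _)).add (e _ _ _ _ _ _)).add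
      (e _ _ _ _ _ _)).sub (e _ _ _ _ _ _)).add (e _ _ _ _ _ _)
  · simp only [Fin.mk_one, beta_one]
    exact ((((((e _ _ _ _ _ _).sub (e _ _ _ _ _ _)).add (e _ _ _ _ _ _)).add
      (e _ _ _ _ _ _)).sub (e _ _ _ _ _ _)).add (e _ _ _ _ _ _)).neg
  · simp only [Fin.reduceFinMk, beta_two]
    exact (((((e _ _ _ _ _ _).sub (e _ _ _ _ _ _)).add (e _ _ _ _ _ _)).add
      (e _ _ _ _ _ _)).sub (e _ _ _ _ _ _)).add (e _ _ _ _ _ _)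
  · simp only [Fin.reduceFinMk, beta_three]
    exact ((((((e _ _ _ _ _ _).sub (e _ _ _ _ _ _)).add (e _ _ _ _ _ _)).add
      (e _ _ _ _ _ _)).sub (e _ _ _ _ _ _)).add (e _ _ _ _ _ _)).neg
  · simp only [Fin.reduceFinMk, beta_four]
    exact (((((e _ _ _ _ _ _).sub (e _ _ _ _ _ _)).add (e _ _ _ _ _ _)).add
      (e _ _ _ _ _ _)).sub (e _ _ _ _ _ _)).add (e _ _ _ _ _ _)

theorem br (i j k l m : Fin 4) : IsForm 5 fun X => br X i j k l m := by
  have : ∀ a b, IsForm (2 + (1 + 2)) fun X : V =>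
      QuinaryAlt.beta (X i) (X j) a * ((X k).1 a b * QuinaryAlt.beta (X l) (X m) b) :=
    fun a b => (beta i j a).mul ((entry k a b).mul (beta l m b))
  simp only [QuinaryAlt.br, dotProduct, mulVec, Finset.mul_sum]
  exact sum _ fun a _ => sum _ fun b _ => this a b

theorem br_mul_br (i j k l m i' j' k' l' m' : Fin 4) :
    IsForm 10 fun X => QuinaryAlt.br X i j k l m * QuinaryAlt.br X i' j' k' l' m' :=
  (br i j k l m).mul (br i' j' k' l' m')

theorem phi11 (τ : Equiv.Perm (Fin 4)) : IsForm 10 fun X => phi11 (permute τ X) := by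
  simp only [QuinaryAlt.phi11, br_permute]
  have b (i j k l m : Fin 4) : IsForm 5 fun X => QuinaryAlt.br X i j k l m := br i j k l m
  have e (i j k l m i' j' k' l' m' : Fin 4) :
      IsForm 10 fun X => QuinaryAlt.br X i j k l m * QuinaryAlt.br X i' j' k' l' m' :=
    br_mul_br i j k l m i' j' k' l' m'
  have t (i j k l m i₁ j₁ k₁ l₁ m₁ i₂ j₂ k₂ l₂ m₂ i₃ j₃ k₃ l₃ m₃ : Fin 4) :
      IsForm 10 fun X => 160 * QuinaryAlt.br X i j k l m * (3 * QuinaryAlt.br X i₁ j₁ k₁ l₁ m₁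
        - 2 * QuinaryAlt.br X i₂ j₂ k₂ l₂ m₂ - 2 * QuinaryAlt.br X i₃ j₃ k₃ l₃ m₃) :=
    ((b _ _ _ _ _).const_mul 160).mul
      ((((b _ _ _ _ _).const_mul 3).sub ((b _ _ _ _ _).const_mul 2)).sub
        ((b _ _ _ _ _).const_mul 2))
  exact (((((t _ _ _ _ _ _ _ _ _ _ _ _ _ _ _ _ _ _ _ _).add
    (t _ _ _ _ _ _ _ _ _ _ _ _ _ _ _ _ _ _ _ _)).add
    (t _ _ _ _ _ _ _ _ _ _ _ _ _ _ _ _ _ _ _ _)).add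
    ((((e _ _ _ _ _ _ _ _ _ _).add (e _ _ _ _ _ _ _ _ _ _)).add
      (e _ _ _ _ _ _ _ _ _ _)).const_mul 50)).sub
    ((((b _ _ _ _ _).pow_two.add (b _ _ _ _ _).pow_two).add
      (b _ _ _ _ _).pow_two).const_mul 288)).add
    ((((e _ _ _ _ _ _ _ _ _ _).add (e _ _ _ _ _ _ _ _ _ _)).add
      (e _ _ _ _ _ _ _ _ _ _)).const_mul 224)

theorem phi12 (τ : Equiv.Perm (Fin 4)) : IsForm 10 fun X => phi12 (permute τ X) := by
  simp only [QuinaryAlt.phi12, br_permute]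
  have b (i j k l m : Fin 4) : IsForm 5 fun X => QuinaryAlt.br X i j k l m := br i j k l m
  have e (i j k l m i' j' k' l' m' : Fin 4) :
      IsForm 10 fun X => QuinaryAlt.br X i j k l m * QuinaryAlt.br X i' j' k' l' m' :=
    br_mul_br i j k l m i' j' k' l' m'
  have cc (c : ℂ) (i j k l m i' j' k' l' m' : Fin 4) :
      IsForm 10 fun X => c * QuinaryAlt.br X i j k l m * QuinaryAlt.br X i' j' k' l' m' :=
    ((b _ _ _ _ _).const_mul c).mul (b _ _ _ _ _)
  have t (i j k l m i₁ j₁ k₁ l₁ m₁ i₂ j₂ k₂ l₂ m₂ i₃ j₃ k₃ l₃ m₃ : Fin 4) :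
      IsForm 10 fun X => 20 * QuinaryAlt.br X i j k l m * (4 * QuinaryAlt.br X i₁ j₁ k₁ l₁ m₁
        - QuinaryAlt.br X i₂ j₂ k₂ l₂ m₂ - QuinaryAlt.br X i₃ j₃ k₃ l₃ m₃) :=
    ((b _ _ _ _ _).const_mul 20).mul
      ((((b _ _ _ _ _).const_mul 4).sub (b _ _ _ _ _)).sub (b _ _ _ _ _))
  have a (i j k l m i₁ j₁ k₁ l₁ m₁ i₂ j₂ k₂ l₂ m₂ : Fin 4) :
      IsForm 10 fun X => QuinaryAlt.br X i j k l m * (QuinaryAlt.br X i₁ j₁ k₁ l₁ m₁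
        + QuinaryAlt.br X i₂ j₂ k₂ l₂ m₂) :=
    (b _ _ _ _ _).mul ((b _ _ _ _ _).add (b _ _ _ _ _))
  have s (c : ℂ) (i j k l m i₁ j₁ k₁ l₁ m₁ i₂ j₂ k₂ l₂ m₂ i₃ j₃ k₃ l₃ m₃ : Fin 4) :
      IsForm 10 fun X => c * (QuinaryAlt.br X i j k l m * QuinaryAlt.br X i₁ j₁ k₁ l₁ m₁
        + QuinaryAlt.br X i₂ j₂ k₂ l₂ m₂ * QuinaryAlt.br X i₃ j₃ k₃ l₃ m₃) :=
    ((e _ _ _ _ _ _ _ _ _ _).add (e _ _ _ _ _ _ _ _ _ _)).const_mul c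
  exact (((((((((cc _ _ _ _ _ _ _ _ _ _ _).sub (s _ _ _ _ _ _ _ _ _ _ _ _ _ _ _ _ _ _ _ _ _)).sub
    (s _ _ _ _ _ _ _ _ _ _ _ _ _ _ _ _ _ _ _ _ _)).add
    (t _ _ _ _ _ _ _ _ _ _ _ _ _ _ _ _ _ _ _ _)).add
    (t _ _ _ _ _ _ _ _ _ _ _ _ _ _ _ _ _ _ _ _)).sub
    (s _ _ _ _ _ _ _ _ _ _ _ _ _ _ _ _ _ _ _ _ _)).add (cc _ _ _ _ _ _ _ _ _ _ _)).add
    (((a _ _ _ _ _ _ _ _ _ _ _ _ _ _ _).add (a _ _ _ _ _ _ _ _ _ _ _ _ _ _ _)).const_mul 112)).add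
    (s _ _ _ _ _ _ _ _ _ _ _ _ _ _ _ _ _ _ _ _ _)).sub
    (s _ _ _ _ _ _ _ _ _ _ _ _ _ _ _ _ _ _ _ _ _)

theorem phi (s t : Fin 4) : IsForm 10 fun X => phi s t X := by
  by_cases h : s = t
  · simpa only [QuinaryAlt.phi, if_pos h] using phi11 _
  · simpa only [QuinaryAlt.phi, if_neg h] using phi12 _

theorem disc : IsForm 40 disc := by
  have h (σ : Equiv.Perm (Fin 4)) : IsForm (10 + 10 + 10 + 10) fun X =>
      QuinaryAlt.phi (σ 0) 0 X * QuinaryAlt.phi (σ 1) 1 X * QuinaryAlt.phi (σ 2) 2 X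
        * QuinaryAlt.phi (σ 3) 3 X :=
    (((phi _ _).mul (phi _ _)).mul (phi _ _)).mul (phi _ _)
  have : QuinaryAlt.disc = fun X => ∑ σ : Equiv.Perm (Fin 4), ((Equiv.Perm.sign σ : ℤ) : ℂ) *
      (QuinaryAlt.phi (σ 0) 0 X * QuinaryAlt.phi (σ 1) 1 X * QuinaryAlt.phi (σ 2) 2 X
        * QuinaryAlt.phi (σ 3) 3 X) := by
    funext X
    simp only [QuinaryAlt.disc, det_apply', Fin.prod_univ_four, phiMat_apply]
  rw [this]
  exact sum _ fun σ _ => (h σ).const_mul _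

end IsForm

/-- The polynomial `f` with the values `det Φ(X)`. -/
noncomputable def discPoly : MvPolynomial Coord ℂ := IsForm.disc.choose

theorem discPoly_isHomogeneous : discPoly.IsHomogeneous 40 := IsForm.disc.choose_spec.1

theorem value_discPoly (X : V) : value discPoly X = disc X := IsForm.disc.choose_spec.2 X

/-! ### Open orbits -/

open Topology in
theorem eq_zero_of_eventually {Q : MvPolynomial Coord ℂ} {x : Coord → ℂ}
    (h : ∀ᶠ y in 𝓝 x, MvPolynomial.eval y Q = 0) : Q = 0 := by
  obtain ⟨ε, hε, hb⟩ := Metric.eventually_nhds_iff_ball.1 h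
  refine MvPolynomial.funext_set (fun i => Metric.ball (x i) ε) (fun i => ?_) fun y hy => ?_
  · exact infinite_of_mem_nhds (x i) (Metric.ball_mem_nhds _ hε)
  · rw [map_zero]
    refine hb y ?_
    rw [ball_pi _ hε]
    exact hy

/-- The infinitesimal version of `conj`. -/
def ad {n : ℕ} (a : Matrix (Fin n) (Fin n) ℂ) (X : Alt n) : Alt n :=
  ⟨a * X.1 + X.1 * aᵀ, by
    have h : X.1ᵀ = -X.1 := X.2
    change (a * X.1 + X.1 * aᵀ)ᵀ = -(a * X.1 + X.1 * aᵀ)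
    simp [transpose_mul, h, add_comm]⟩

theorem ad_coe {n : ℕ} (a : Matrix (Fin n) (Fin n) ℂ) (X : Alt n) :
    (ad a X).1 = a * X.1 + X.1 * aᵀ := rfl

/-- The infinitesimal action of `gl_5 × gl_4`. -/
def infAct (a : Matrix (Fin 5) (Fin 5) ℂ) (b : Matrix (Fin 4) (Fin 4) ℂ) (X : V) : V :=
  (fun n => ad a (X n)) + mix b X

theorem mix_add_left (B C : Matrix (Fin 4) (Fin 4) ℂ) (X : V) :
    mix (B + C) X = mix B X + mix C X := by
  funext i
  simp [mix, add_smul, Finset.sum_add_distrib]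

theorem mix_smul_left (c : ℂ) (B : Matrix (Fin 4) (Fin 4) ℂ) (X : V) :
    mix (c • B) X = c • mix B X := by
  funext i
  simp [mix, smul_smul, Finset.smul_sum]

theorem mix_add (B : Matrix (Fin 4) (Fin 4) ℂ) (X Y : V) : mix B (X + Y) = mix B X + mix B Y := by
  funext i
  simp [mix, Finset.sum_add_distrib]

theorem mix_smul (c : ℂ) (B : Matrix (Fin 4) (Fin 4) ℂ) (X : V) : mix B (c • X) = c • mix B X := by
  funext i
  simp [mix, smul_comm c, Finset.smul_sum]

theorem conj_smul_left {n : ℕ} (c : ℂ) (A : Matrix (Fin n) (Fin n) ℂ) (X : Alt n) :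
    conj (c • A) X = c ^ 2 • conj A X := by
  ext1
  simp [conj, smul_smul, sq]

theorem conj_one_add {n : ℕ} (a : Matrix (Fin n) (Fin n) ℂ) (X : Alt n) :
    conj (1 + a) X = X + ad a X + conj a X := by
  ext1
  simp only [conj_coe, ad_coe, Submodule.coe_add, transpose_add, transpose_one]
  noncomm_ring

theorem ad_smul_left {n : ℕ} (c : ℂ) (a : Matrix (Fin n) (Fin n) ℂ) (X : Alt n) :
    ad (c • a) X = c • ad a X := by
  ext1
  simp [ad_coe]

theorem ad_add_left {n : ℕ} (a b : Matrix (Fin n) (Fin n) ℂ) (X : Alt n) :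
    ad (a + b) X = ad a X + ad b X := by
  ext1
  simp only [ad_coe, Submodule.coe_add, transpose_add]
  noncomm_ring

/-- `A` enters quadratically and `B` linearly, so these curves are cubic. The linear coefficient is
the derivative of the orbit map, and the whole expansion serves to restrict polynomials to such
curves. -/
theorem act_one_add (c : ℂ) (a : Matrix (Fin 5) (Fin 5) ℂ) (b : Matrix (Fin 4) (Fin 4) ℂ) (X : V) :
    mix (1 + c • b) (fun n => conj (1 + c • a) (X n)) =
      X + c • infAct a b X + c ^ 2 • ((fun n => conj a (X n)) + mix b fun n => ad a (X n))
        + c ^ 3 • mix b fun n => conj a (X n) := by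
  have h : (fun n => conj (1 + c • a) (X n)) =
      X + c • (fun n => ad a (X n)) + c ^ 2 • fun n => conj a (X n) := by
    funext n
    rw [conj_one_add, ad_smul_left, conj_smul_left]
    rfl
  rw [h, mix_add_left, mix_one, mix_smul_left, mix_add, mix_add, mix_smul, mix_smul, infAct]
  module

/-- A scalar `z` in `GL_5` acts as the scalar `z²` in `GL_4`, so `GL_5 × GL_4` has the same orbits
as `SL_5 × GL_4`. -/
theorem rho_surj_of_det_ne_zero {A : Matrix (Fin 5) (Fin 5) ℂ} {B : Matrix (Fin 4) (Fin 4) ℂ}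
    (hA : A.det ≠ 0) (hB : B.det ≠ 0) (X : V) :
    ∃ g : G, rho g X = mix B fun n => conj A (X n) := by
  obtain ⟨z, hz⟩ := IsAlgClosed.exists_pow_nat_eq A.det (n := 5) (by norm_num)
  have hz0 : z ≠ 0 := by
    rintro rfl
    exact hA (by rw [← hz]; norm_num)
  have h1 : (z⁻¹ • A).det = 1 := by
    rw [det_smul, Fintype.card_fin, ← hz]
    field_simp
  have h2 : (z ^ 2 • B).det ≠ 0 := by
    rw [det_smul]
    positivity
  refine ⟨⟨⟨z⁻¹ • A, h1⟩, GeneralLinearGroup.mkOfDetNeZero (z ^ 2 • B) h2⟩, ?_⟩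
  rw [rho_apply]
  change mix (z ^ 2 • B) (fun n => conj (z⁻¹ • A) (X n)) = _
  have : (fun n => conj (z⁻¹ • A) (X n)) = (z⁻¹ ^ 2) • fun n => conj A (X n) := by
    funext n
    rw [conj_smul_left]
    rfl
  rw [this, mix_smul_left, mix_smul, smul_smul, ← mul_pow, mul_inv_cancel₀ hz0, one_pow, one_smul]

theorem coord_apply (X : V) (c : Coord) : coord X c = (X c.1).1 c.2.1.1 c.2.1.2 := rfl

/-- Pairs of matrices, as a product of normed spaces. -/
abbrev Param : Type := (Fin 5 → Fin 5 → ℂ) × (Fin 4 → Fin 4 → ℂ)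

/-- The pair of identity matrices. -/
def paramOne : Param := ((1 : Matrix (Fin 5) (Fin 5) ℂ), (1 : Matrix (Fin 4) (Fin 4) ℂ))

/-- The orbit map in coordinates, on pairs of matrices. -/
def orbitMap (X : V) (w : Param) : Coord → ℂ :=
  coord (mix (of w.2) fun n => conj (of w.1) (X n))

theorem orbitMap_apply (X : V) (w : Param) (c : Coord) :
    orbitMap X w c = ∑ j, w.2 c.1 j *
      ∑ q, (∑ p, w.1 c.2.1.1 p * (X j).1 p q) * w.1 c.2.1.2 q := by
  simp only [orbitMap, coord_apply, mix, Submodule.coe_sum, Submodule.coe_smul, Matrix.sum_apply,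
      Matrix.smul_apply, conj_coe, mul_apply,
    transpose_apply, of_apply, smul_eq_mul]

theorem contDiff_orbitMap (X : V) : ContDiff ℂ 1 (orbitMap X) := by
  rw [contDiff_pi]
  intro c
  simp only [orbitMap_apply]
  fun_prop

theorem hasDerivAt_orbitMap (X : V) (a : Matrix (Fin 5) (Fin 5) ℂ) (b : Matrix (Fin 4) (Fin 4) ℂ) :
    HasDerivAt (fun c : ℂ => orbitMap X (paramOne + c • ((a, b) : Param)))
      (coord (infAct a b X)) 0 := by
  have e : (fun c : ℂ => orbitMap X (paramOne + c • ((a, b) : Param))) =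
      fun c => coord X + c • coord (infAct a b X)
        + c ^ 2 • coord ((fun n => conj a (X n)) + mix b fun n => ad a (X n))
        + c ^ 3 • coord (mix b fun n => conj a (X n)) := by
    funext c
    rw [← map_smul, ← map_smul, ← map_smul, ← map_add, ← map_add, ← map_add, ← act_one_add]
    rfl
  rw [e]
  have h1 := (hasDerivAt_id (0 : ℂ)).smul_const (coord (infAct a b X))
  have h2 := ((hasDerivAt_id (0 : ℂ)).pow 2).smul_const
    (coord ((fun n => conj a (X n)) + mix b fun n => ad a (X n)))
  have h3 := ((hasDerivAt_id (0 : ℂ)).pow 3).smul_const (coord (mix b fun n => conj a (X n)))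
  refine (((h1.const_add (coord X)).add h2).add h3).congr_deriv ?_
  simp

open Topology in
/-- When the infinitesimal action is surjective at `X`, the orbit is a neighbourhood of `X`. -/
theorem orbit_mem_nhds {X : V} (hX : ∀ Y, ∃ a b, infAct a b X = Y) :
    ∀ᶠ y in 𝓝 (coord X), ∃ g : G, coord (rho g X) = y := by
  have hs : HasStrictFDerivAt (orbitMap X) (fderiv ℂ (orbitMap X) paramOne) paramOne :=
    (contDiff_orbitMap X).contDiffAt.hasStrictFDerivAt one_ne_zero
  have hparamOne : orbitMap X paramOne = coord X := by
    change coord (mix 1 fun n => conj 1 (X n)) = _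
    simp only [conj_one, mix_one]
  have hr : ((fderiv ℂ (orbitMap X) paramOne : Param →L[ℂ] (Coord → ℂ)) :
      Param →ₗ[ℂ] (Coord → ℂ)).range = ⊤ := by
    rw [LinearMap.range_eq_top]
    intro y
    obtain ⟨a, b, hab⟩ := hX (coord.symm y)
    refine ⟨(a, b), ?_⟩
    -- The total derivative in the direction `(a, b)` is identified by uniqueness of the derivative
    -- along a line.
    have h1 : HasDerivAt _ _ _ := hs.hasFDerivAt.hasLineDerivAt (a, b)
    have h2 := hasDerivAt_orbitMap X a b
    have := h1.unique h2
    rw [hab, LinearEquiv.apply_symm_apply] at this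
    exact this
  have hmap := hs.map_nhds_eq_of_surj hr
  rw [hparamOne] at hmap
  rw [← hmap, Filter.eventually_map]
  have hA : ∀ᶠ w : Param in 𝓝 paramOne, (of w.1).det ≠ 0 := by
    have hc : Continuous fun w : Param => (of w.1).det :=
      Continuous.matrix_det continuous_fst
    refine hc.continuousAt.eventually_ne ?_
    change (1 : Matrix (Fin 5) (Fin 5) ℂ).det ≠ 0
    simp
  have hB : ∀ᶠ w : Param in 𝓝 paramOne, (of w.2).det ≠ 0 := by
    have hc : Continuous fun w : Param => (of w.2).det :=
      Continuous.matrix_det continuous_snd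
    refine hc.continuousAt.eventually_ne ?_
    change (1 : Matrix (Fin 4) (Fin 4) ℂ).det ≠ 0
    simp
  filter_upwards [hA, hB] with w h1 h2
  obtain ⟨g, hg⟩ := rho_surj_of_det_ne_zero h1 h2 X
  exact ⟨g, by rw [hg]; rfl⟩

/-! ### The base point and its orbit -/

/-- A point in the open orbit. -/
def base : V := family 1 1 1

theorem disc_base : disc base = -71663616000 := by
  rw [base, disc_family]
  norm_num

theorem alt_five_ext {X Y : Alt 5} (h01 : X.1 0 1 = Y.1 0 1) (h02 : X.1 0 2 = Y.1 0 2)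
    (h03 : X.1 0 3 = Y.1 0 3) (h04 : X.1 0 4 = Y.1 0 4) (h12 : X.1 1 2 = Y.1 1 2)
    (h13 : X.1 1 3 = Y.1 1 3) (h14 : X.1 1 4 = Y.1 1 4) (h23 : X.1 2 3 = Y.1 2 3)
    (h24 : X.1 2 4 = Y.1 2 4) (h34 : X.1 3 4 = Y.1 3 4) : X = Y := by
  ext a b
  fin_cases a <;> fin_cases b <;>
    simp only [Fin.zero_eta, Fin.mk_one, Fin.reduceFinMk, alt_diag, alt_apply _ 1 0,
      alt_apply _ 2 0, alt_apply _ 3 0, alt_apply _ 4 0, alt_apply _ 2 1, alt_apply _ 3 1,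
      alt_apply _ 4 1, alt_apply _ 3 2, alt_apply _ 4 2, alt_apply _ 4 3, h01, h02, h03, h04, h12,
      h13, h14, h23, h24, h34]

theorem infAct_coe (a : Matrix (Fin 5) (Fin 5) ℂ) (b : Matrix (Fin 4) (Fin 4) ℂ) (X : V)
    (k : Fin 4) (p q : Fin 5) : (infAct a b X k).1 p q =
      (∑ r, a p r * (X k).1 r q) + (∑ r, (X k).1 p r * a q r) + ∑ j, b k j * (X j).1 p q := by
  simp only [infAct, Pi.add_apply, Submodule.coe_add, Matrix.add_apply, ad_coe, mul_apply,
    transpose_apply, mix, Submodule.coe_sum, Submodule.coe_smul, Matrix.sum_apply,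
    Matrix.smul_apply, smul_eq_mul]

set_option maxHeartbeats 4000000 in
theorem infAct_base_surjective (Y : V) : ∃ a b, infAct a b base = Y := by
  obtain ⟨y, hy⟩ : ∃ y : Fin 4 → Fin 5 → Fin 5 → ℂ, y = fun k p q => (Y k).1 p q := ⟨_, rfl⟩
  -- An explicit solution of the linear system in 41 unknowns and 40 equations. It is unique up to
  -- multiples of `(1, -2 • 1)`, and is normalized here by `a 1 1 = 0`.
  refine ⟨!![(1 / 2) * y 0 0 3 - (1 / 2) * y 0 1 4 + (1 / 2) * y 1 0 4 - (1 / 2) * y 1 1 3,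
      (1 / 2) * y 0 0 4 - (1 / 2) * y 0 1 3 + (1 / 2) * y 1 0 3 - (1 / 2) * y 1 1 4 + y 2 1 2,
      3 * y 0 1 2 - y 1 0 2 + y 1 3 4 + 2 * y 2 2 3 + y 3 0 4 - y 3 1 3,
      -2 * y 0 2 3 - y 1 0 1 + y 1 2 4 - y 3 1 2,
      -(1 / 3) * y 0 0 1 + (1 / 3) * y 0 2 4 - (1 / 3) * y 2 0 3 + (1 / 3) * y 2 1 4 - (1 / 3) *
          y 3 0 2 + (1 / 3) * y 3 3 4;
      y 2 1 2,
      0,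
      -(1 / 3) * y 0 0 2 + (1 / 3) * y 0 3 4 + y 1 1 2 + (2 / 3) * y 2 0 1 - (2 / 3) * y 2 2 4 -
          (1 / 3) * y 3 0 3 + (1 / 3) * y 3 1 4,
      (2 / 3) * y 0 0 1 - (2 / 3) * y 0 2 4 + y 1 2 3 - (1 / 3) * y 2 0 3 + (1 / 3) * y 2 1 4 -
          (1 / 3) * y 3 0 2 + (1 / 3) * y 3 3 4,
      -y 0 2 3 - y 3 1 2;
      y 0 2 3,
      y 1 2 3,
      (1 / 3) * y 0 0 3 - (1 / 3) * y 0 1 4 + (1 / 3) * y 2 0 2 - (1 / 3) * y 2 3 4 - (2 / 3) * y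
          3 0 1 + (2 / 3) * y 3 2 4,
      y 1 1 2,
      y 0 1 2;
      -y 0 1 2 - y 2 2 3,
      -(2 / 3) * y 0 0 2 + (2 / 3) * y 0 3 4 + y 1 1 2 + (1 / 3) * y 2 0 1 - (1 / 3) * y 2 2 4 +
          (1 / 3) * y 3 0 3 - (1 / 3) * y 3 1 4,
      (1 / 3) * y 0 0 1 - (1 / 3) * y 0 2 4 + y 1 2 3 + (1 / 3) * y 2 0 3 - (1 / 3) * y 2 1 4 -
          (2 / 3) * y 3 0 2 + (2 / 3) * y 3 3 4,
      (2 / 3) * y 0 0 3 - (2 / 3) * y 0 1 4 - (1 / 3) * y 2 0 2 + (1 / 3) * y 2 3 4 - (1 / 3) * y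
          3 0 1 + (1 / 3) * y 3 2 4,
      y 3 2 3;
      (1 / 3) * y 0 0 2 - (1 / 3) * y 0 3 4 + (1 / 3) * y 2 0 1 - (1 / 3) * y 2 2 4 + (1 / 3) * y
          3 0 3 - (1 / 3) * y 3 1 4,
      -2 * y 0 1 2 + y 1 0 2 - y 1 3 4 - y 2 2 3,
      3 * y 0 2 3 + y 1 0 1 - y 1 2 4 + y 2 0 4 - y 2 1 3 + 2 * y 3 1 2,
      (1 / 2) * y 0 0 4 - (1 / 2) * y 0 1 3 - (1 / 2) * y 1 0 3 + (1 / 2) * y 1 1 4 + y 3 2 3,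
      (1 / 6) * y 0 0 3 - (1 / 6) * y 0 1 4 + (1 / 2) * y 1 0 4 - (1 / 2) * y 1 1 3 - (1 / 3) * y
          2 0 2 + (1 / 3) * y 2 3 4 - (1 / 3) * y 3 0 1 + (1 / 3) * y 3 2 4], !![-(1 / 6) * y 0 0
              3 + (7 / 6) * y 0 1 4 - (1 / 2) * y 1 0 4 + (1 / 2) * y 1 1 3 + (1 / 3) * y 2 0 2 -
                  (1 / 3) * y 2 3 4 + (1 / 3) * y 3 0 1 - (1 / 3) * y 3 2 4,
      y 0 1 3 - y 2 1 2 - y 3 2 3,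
      y 0 0 2 - y 1 1 2,
      y 0 2 4 - y 1 2 3;
      -(1 / 2) * y 0 0 4 + (1 / 2) * y 0 1 3 + (1 / 2) * y 1 0 3 + (1 / 2) * y 1 1 4 - y 2 1 2 -
          y 3 2 3,
      -(2 / 3) * y 0 0 3 + (2 / 3) * y 0 1 4 + y 1 1 3 + (1 / 3) * y 2 0 2 - (1 / 3) * y 2 3 4 +
          (1 / 3) * y 3 0 1 - (1 / 3) * y 3 2 4,
      -y 0 1 2 + y 1 0 2,
      -y 0 2 3 + y 1 2 4;
      -(2 / 3) * y 0 0 1 + (2 / 3) * y 0 2 4 - y 1 2 3 + (1 / 3) * y 2 0 3 + (2 / 3) * y 2 1 4 +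
          (1 / 3) * y 3 0 2 - (1 / 3) * y 3 3 4,
      -y 0 2 3 + y 2 1 3 - y 3 1 2,
      -(5 / 6) * y 0 0 3 + (5 / 6) * y 0 1 4 - (1 / 2) * y 1 0 4 + (1 / 2) * y 1 1 3 + (2 / 3) *
          y 2 0 2 + (1 / 3) * y 2 3 4 + (2 / 3) * y 3 0 1 - (2 / 3) * y 3 2 4,
      (1 / 3) * y 0 0 2 - (1 / 3) * y 0 3 4 - y 1 1 2 + (1 / 3) * y 2 0 1 + (2 / 3) * y 2 2 4 +
          (1 / 3) * y 3 0 3 - (1 / 3) * y 3 1 4;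
      (2 / 3) * y 0 0 2 - (2 / 3) * y 0 3 4 - y 1 1 2 - (1 / 3) * y 2 0 1 + (1 / 3) * y 2 2 4 +
          (2 / 3) * y 3 0 3 + (1 / 3) * y 3 1 4,
      -y 0 1 2 - y 2 2 3 + y 3 1 3,
      -(1 / 3) * y 0 0 1 + (1 / 3) * y 0 2 4 - y 1 2 3 - (1 / 3) * y 2 0 3 + (1 / 3) * y 2 1 4 +
          (2 / 3) * y 3 0 2 + (1 / 3) * y 3 3 4,
      -(1 / 2) * y 0 0 3 + (1 / 2) * y 0 1 4 - (1 / 2) * y 1 0 4 + (1 / 2) * y 1 1 3 + y 3 0 1], ?_⟩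
  have h (k : Fin 4) (p q : Fin 5) : (Y k).1 p q = y k p q := by rw [hy]
  clear hy
  funext k
  fin_cases k <;> refine alt_five_ext ?_ ?_ ?_ ?_ ?_ ?_ ?_ ?_ ?_ ?_ <;>
  · simp only [Fin.zero_eta, Fin.mk_one, Fin.reduceFinMk, infAct_coe, h, Fin.sum_univ_five,
      Fin.sum_univ_four, base, family_zero, family_one, family_two, family_three]
    simp
    try ring

/-- Membership in the orbit of the base point. -/
def InOrbit (X : V) : Prop := ∃ g : G, rho g base = X

theorem inOrbit_base : InOrbit base := ⟨1, by rw [map_one]; rfl⟩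

theorem InOrbit.rho {X : V} (h : InOrbit X) (g : G) : InOrbit (rho g X) := by
  obtain ⟨g', rfl⟩ := h
  exact ⟨g * g', by rw [map_mul]; rfl⟩

/-- `X ↦ A X ᵗA` on quadruples. -/
def conjAll (A : Matrix (Fin 5) (Fin 5) ℂ) (X : V) : V := fun n => conj A (X n)

theorem conjAll_mul (A B : Matrix (Fin 5) (Fin 5) ℂ) (X : V) :
    conjAll (A * B) X = conjAll A (conjAll B X) := funext fun n => conj_mul A B (X n)

theorem conjAll_one (X : V) : conjAll 1 X = X := funext fun n => conj_one (X n)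

theorem conjAll_smul (A : Matrix (Fin 5) (Fin 5) ℂ) (c : ℂ) (X : V) :
    conjAll A (c • X) = c • conjAll A X := funext fun n => map_smul (conj A) c (X n)

theorem InOrbit.mix_conjAll {X : V} (h : InOrbit X) {A : Matrix (Fin 5) (Fin 5) ℂ}
    {B : Matrix (Fin 4) (Fin 4) ℂ} (hA : A.det = 1) (hB : B.det ≠ 0) :
    InOrbit (mix B (conjAll A X)) :=
  h.rho ⟨⟨A, hA⟩, GeneralLinearGroup.mkOfDetNeZero B hB⟩

theorem InOrbit.conjAll {X : V} (h : InOrbit X) {A : Matrix (Fin 5) (Fin 5) ℂ} (hA : A.det = 1) :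
    InOrbit (conjAll A X) := by
  have := h.mix_conjAll hA (B := 1) (by simp)
  rwa [mix_one] at this

theorem InOrbit.mix {X : V} (h : InOrbit X) {B : Matrix (Fin 4) (Fin 4) ℂ} (hB : B.det ≠ 0) :
    InOrbit (mix B X) := by
  have := h.mix_conjAll (A := 1) (by simp) hB
  rwa [conjAll_one] at this

theorem InOrbit.smul {X : V} (h : InOrbit X) {c : ℂ} (hc : c ≠ 0) : InOrbit (c • X) := by
  have := h.mix (B := c • 1) (by rw [det_smul, det_one, mul_one]; exact pow_ne_zero _ hc)
  rwa [mix_smul_left, mix_one] at this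

/-- The orbit contains a neighbourhood of `base`, and a polynomial vanishing on a nonempty open set
is zero. -/
theorem eq_of_eqOn_orbit {P Q : MvPolynomial Coord ℂ}
    (h : ∀ X, InOrbit X → value P X = value Q X) : P = Q := by
  rw [← sub_eq_zero]
  refine eq_zero_of_eventually (x := coord base) ?_
  filter_upwards [orbit_mem_nhds infAct_base_surjective] with y ⟨g, hg⟩
  rw [map_sub, sub_eq_zero, ← hg]
  exact h _ ⟨g, rfl⟩

/-! ### Polynomials without zeros on the open orbit -/

theorem exists_polynomial_of_path (P : MvPolynomial Coord ℂ) (X U W Z : V) :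
    ∃ q : Polynomial ℂ, ∀ t : ℂ, q.eval t = value P (X + t • U + t ^ 2 • W + t ^ 3 • Z) := by
  refine ⟨MvPolynomial.eval₂ Polynomial.C (fun c => Polynomial.C (coord X c)
    + Polynomial.X * Polynomial.C (coord U c) + Polynomial.X ^ 2 * Polynomial.C (coord W c)
    + Polynomial.X ^ 3 * Polynomial.C (coord Z c)) P, fun t => ?_⟩
  rw [← Polynomial.coe_evalRingHom, MvPolynomial.hom_eval₂, value, MvPolynomial.eval,
    MvPolynomial.coe_eval₂Hom]
  congr 1
  · ext c; simp
  · funext c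
    simp
    ring

theorem eval_eq_of_forall_ne_zero {q : Polynomial ℂ} (h : ∀ t, q.eval t ≠ 0) (s t : ℂ) :
    q.eval s = q.eval t := by
  have hd : q.degree = 0 := by
    by_contra hd
    obtain ⟨x, hx⟩ := IsAlgClosed.exists_root q hd
    exact h x hx
  rw [Polynomial.eq_C_of_degree_eq_zero hd, Polynomial.eval_C, Polynomial.eval_C]

/-- After the power of the variable is divided out, no root is left, so the cofactor is constant. -/
theorem eval_eq_mul_pow_of_forall_ne_zero {q : Polynomial ℂ} (h : ∀ t, t ≠ 0 → q.eval t ≠ 0) :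
    ∃ k : ℕ, ∀ t, q.eval t = q.eval 1 * t ^ k := by
  have hq : q ≠ 0 := by
    rintro rfl
    exact h 1 one_ne_zero Polynomial.eval_zero
  obtain ⟨r, hr, hr0⟩ := Polynomial.exists_eq_pow_rootMultiplicity_mul_and_not_dvd q hq 0
  have hne : ∀ t, r.eval t ≠ 0 := by
    intro t ht
    by_cases h0 : t = 0
    · rw [h0] at ht
      exact hr0 (Polynomial.dvd_iff_isRoot.2 ht)
    · exact h t h0 (by rw [hr, Polynomial.eval_mul, ht, mul_zero])
  refine ⟨Polynomial.rootMultiplicity 0 q, fun t => ?_⟩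
  have e (t : ℂ) : q.eval t = t ^ Polynomial.rootMultiplicity 0 q * r.eval 0 := by
    conv_lhs => rw [hr]
    simp [eval_eq_of_forall_ne_zero hne t 0]
  rw [e t, e 1, one_pow, one_mul, mul_comm]

section NonVanishing

variable {P : MvPolynomial Coord ℂ}

/-- For a transvection with parameter `t`, the value of `P` is a polynomial in `t` without zeros,
hence equal to its value at `t = 0`. No equivariance of `P` is presupposed. -/
theorem value_conjAll (hP : ∀ X, InOrbit X → value P X ≠ 0)
    {A : Matrix (Fin 5) (Fin 5) ℂ} (hA : A.det = 1) {X : V} (hX : InOrbit X) :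
    value P (conjAll A X) = value P X := by
  refine (transvection_induction (p := fun A => A.det = 1 ∧ ∀ X, InOrbit X →
    value P (conjAll A X) = value P X) ⟨det_one, fun X _ => by rw [conjAll_one]⟩
    (fun i j h c => ⟨det_transvection_of_ne i j h c, fun X hX => ?_⟩)
    (fun A B hA hB => ⟨by rw [det_mul, hA.1, hB.1, one_mul], fun X hX => ?_⟩) A hA).2 X hX
  · have e (t : ℂ) := act_one_add t (single i j 1) 0 X
    obtain ⟨q, hq⟩ := exists_polynomial_of_path P X (infAct (single i j 1) 0 X)
      ((fun n => conj (single i j 1) (X n)) + mix 0 fun n => ad (single i j 1) (X n))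
      (mix 0 fun n => conj (single i j 1) (X n))
    have hq' (t : ℂ) : q.eval t = value P (conjAll (transvection i j t) X) := by
      rw [hq, ← e, smul_zero, add_zero, mix_one, transvection, smul_single, smul_eq_mul, mul_one]
      rfl
    rw [← hq', eval_eq_of_forall_ne_zero (fun t => ?_) c 0, hq', transvection_zero, conjAll_one]
    rw [hq']
    exact hP _ (hX.conjAll (det_transvection_of_ne i j h t))
  · rw [conjAll_mul, hA.2 _ (hX.conjAll hB.1), hB.2 _ hX]

theorem value_mix (hP : ∀ X, InOrbit X → value P X ≠ 0)
    {B : Matrix (Fin 4) (Fin 4) ℂ} (hB : B.det = 1) {X : V} (hX : InOrbit X) :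
    value P (mix B X) = value P X := by
  refine (transvection_induction (p := fun B => B.det = 1 ∧ ∀ X, InOrbit X →
    value P (mix B X) = value P X) ⟨det_one, fun X _ => by rw [mix_one]⟩
    (fun i j h c => ⟨det_transvection_of_ne i j h c, fun X hX => ?_⟩)
    (fun A B hA hB => ⟨by rw [det_mul, hA.1, hB.1, one_mul], fun X hX => ?_⟩) B hB).2 X hX
  · have e (t : ℂ) : mix (transvection i j t) X =
        X + t • mix (single i j 1) X + t ^ 2 • (0 : V) + t ^ 3 • (0 : V) := by
      have : transvection i j t = 1 + t • single i j (1 : ℂ) := by simp [transvection]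
      rw [this, mix_add_left, mix_one, mix_smul_left]
      simp
    obtain ⟨q, hq⟩ := exists_polynomial_of_path P X (mix (single i j 1) X) 0 0
    have hq' (t : ℂ) : q.eval t = value P (mix (transvection i j t) X) := by rw [hq, e]
    rw [← hq', eval_eq_of_forall_ne_zero (fun t => ?_) c 0, hq', transvection_zero, mix_one]
    rw [hq']
    refine hP _ (hX.mix ?_)
    rw [det_transvection_of_ne i j h t]
    exact one_ne_zero
  · rw [mix_mul, hA.2 _ (hX.mix (by rw [hB.1]; exact one_ne_zero)), hB.2 _ hX]

theorem exists_pow_eq_mul_discPoly_pow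
    (hP : ∀ X, InOrbit X → value P X ≠ 0) :
    ∃ c : ℂ, c ≠ 0 ∧ ∃ k : ℕ, P ^ 40 = MvPolynomial.C c * discPoly ^ k := by
  obtain ⟨q, hq⟩ := exists_polynomial_of_path P 0 base 0 0
  have hq' (t : ℂ) : q.eval t = value P (t • base) := by rw [hq]; simp
  obtain ⟨k, hk⟩ := eval_eq_mul_pow_of_forall_ne_zero (q := q) fun t ht => by
    rw [hq']
    exact hP _ (inOrbit_base.smul ht)
  have h1 : q.eval 1 ≠ 0 := by
    rw [hq', one_smul]
    exact hP _ inOrbit_base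
  have hb : disc base ≠ 0 := by rw [disc_base]; norm_num
  refine ⟨q.eval 1 ^ 40 / disc base ^ k, div_ne_zero (pow_ne_zero _ h1) (pow_ne_zero _ hb), k,
    eq_of_eqOn_orbit ?_⟩
  rintro _ ⟨g, rfl⟩
  set A := (g.1 : Matrix (Fin 5) (Fin 5) ℂ)
  set B := (g.2 : Matrix (Fin 4) (Fin 4) ℂ) with hBdef
  have hB : B.det ≠ 0 := g.2.det_ne_zero
  -- Writing `B = z B'` with `det B' = 1`, the values at `rho g base` are `P(base) z ^ k` and
  -- `f(base) z ^ 40`. The 40th power of the first and the `k`-th power of the second are therefore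
  -- proportional.
  obtain ⟨z, hz⟩ := IsAlgClosed.exists_pow_nat_eq B.det (n := 4) (by norm_num)
  have hz0 : z ≠ 0 := by
    rintro rfl
    exact hB (by rw [← hz]; norm_num)
  have hB' : (z⁻¹ • B).det = 1 := by
    rw [det_smul, Fintype.card_fin, ← hz]
    field_simp
  have hr : rho g base = mix (z⁻¹ • B) (conjAll A (z • base)) := by
    rw [conjAll_smul, mix_smul_left, mix_smul, smul_smul, inv_mul_cancel₀ hz0, one_smul]
    rfl
  have hX : InOrbit (z • base) := inOrbit_base.smul hz0
  rw [value_pow, value_mul, value_C, value_pow, value_discPoly, disc_rho, ← hBdef, ← hz, hr,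
    value_mix hP hB' (hX.conjAll g.1.2), value_conjAll hP g.1.2 hX, ← hq', hk z]
  field_simp
  ring

end NonVanishing

/-! ### The complement of the zero set of `f` is one orbit -/

/-- These scalars lie in the kernel of the infinitesimal action at every point. The trace, nonzero
on them, is the extra coordinate that makes `infMap` a map between spaces of equal dimension `25 +
16 = 40 + 1`. -/
theorem infAct_neg_two (X : V) : infAct 1 ((-2 : ℂ) • 1) X = 0 := by
  rw [infAct, mix_smul_left, mix_one]
  funext n
  ext1
  simp only [Pi.add_apply, Submodule.coe_add, ad_coe, transpose_one, Matrix.one_mul, Matrix.mul_one,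
    Pi.smul_apply, Submodule.coe_smul, Pi.zero_apply, Submodule.coe_zero]
  module

theorem infAct_add_left (a a' : Matrix (Fin 5) (Fin 5) ℂ) (b b' : Matrix (Fin 4) (Fin 4) ℂ) (X :
    V) :
    infAct (a + a') (b + b') X = infAct a b X + infAct a' b' X := by
  simp only [infAct, mix_add_left, ad_add_left]
  have : (fun n => ad a (X n) + ad a' (X n)) = (fun n => ad a (X n)) + fun n => ad a' (X n) := rfl
  rw [this]
  abel

theorem infAct_smul_left (c : ℂ) (a : Matrix (Fin 5) (Fin 5) ℂ) (b : Matrix (Fin 4) (Fin 4) ℂ)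
    (X : V) : infAct (c • a) (c • b) X = c • infAct a b X := by
  simp only [infAct, mix_smul_left, ad_smul_left, smul_add]
  rfl

/-- The infinitesimal action, augmented by the trace, at a fixed point. -/
def infMap (X : V) :
    (Matrix (Fin 5) (Fin 5) ℂ × Matrix (Fin 4) (Fin 4) ℂ) →ₗ[ℂ] V × ℂ where
  toFun w := (infAct w.1 w.2 X, w.1.trace)
  map_add' w w' := by
    rw [Prod.fst_add, Prod.snd_add, infAct_add_left, trace_add, Prod.mk_add_mk]
  map_smul' c w := by
    rw [Prod.smul_fst, Prod.smul_snd, infAct_smul_left, trace_smul, RingHom.id_apply, Prod.smul_mk]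

theorem infMap_apply (X : V) (w : Matrix (Fin 5) (Fin 5) ℂ × Matrix (Fin 4) (Fin 4) ℂ) :
    infMap X w = (infAct w.1 w.2 X, w.1.trace) := rfl

theorem infMap_surjective_iff (X : V) :
    Function.Surjective (infMap X) ↔ ∀ Y, ∃ a b, infAct a b X = Y := by
  constructor
  · intro h Y
    obtain ⟨⟨a, b⟩, hab⟩ := h (Y, 0)
    exact ⟨a, b, congrArg Prod.fst hab⟩
  · rintro h ⟨Y, c⟩
    obtain ⟨a, b, hab⟩ := h Y
    refine ⟨(a, b) + ((c - a.trace) / 5) • (1, (-2 : ℂ) • 1), ?_⟩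
    rw [map_add, map_smul, infMap_apply, infMap_apply, hab, infAct_neg_two, trace_one]
    ext1
    · simp
    · simp only [Prod.snd_add, Prod.smul_snd, Fintype.card_fin, smul_eq_mul]
      push_cast
      ring

theorem finrank_eq : Module.finrank ℂ (Matrix (Fin 5) (Fin 5) ℂ × Matrix (Fin 4) (Fin 4) ℂ) =
    Module.finrank ℂ (V × ℂ) := by
  have hV : Module.finrank ℂ V = 40 := by
    rw [coord.finrank_eq, Module.finrank_fintype_fun_eq_card]
    rfl
  have : Module.Finite ℂ V := Module.Finite.equiv coord.symm
  rw [Module.finrank_prod, Module.finrank_prod, hV, Module.finrank_matrix, Module.finrank_matrix]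
  simp

theorem infMap_bijective {X : V} (h : ∀ Y, ∃ a b, infAct a b X = Y) :
    Function.Bijective (infMap X) := by
  have : Module.Finite ℂ V := Module.Finite.equiv coord.symm
  have hs := (infMap_surjective_iff X).2 h
  exact ⟨(LinearMap.injective_iff_surjective_of_finrank_eq_finrank finrank_eq).2 hs, hs⟩

/-- Compatibility with the adjoint action, which carries surjectivity from `base` to its whole
orbit. -/
theorem infAct_rho (g : G) (X : V) (a : Matrix (Fin 5) (Fin 5) ℂ) (b : Matrix (Fin 4) (Fin 4) ℂ) :
    infAct ((g.1 : Matrix (Fin 5) (Fin 5) ℂ) * a * ((g⁻¹).1 : Matrix (Fin 5) (Fin 5) ℂ))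
      ((g.2 : Matrix (Fin 4) (Fin 4) ℂ) * b * ((g⁻¹).2 : Matrix (Fin 4) (Fin 4) ℂ)) (rho g X) =
    rho g (infAct a b X) := by
  have hA : ((g⁻¹).1 : Matrix (Fin 5) (Fin 5) ℂ) * (g.1 : Matrix (Fin 5) (Fin 5) ℂ) = 1 :=
    congrArg Subtype.val (inv_mul_cancel g.1)
  have hB : ((g⁻¹).2 : Matrix (Fin 4) (Fin 4) ℂ) * (g.2 : Matrix (Fin 4) (Fin 4) ℂ) = 1 :=
    congrArg Units.val (inv_mul_cancel g.2)
  generalize ((g⁻¹).1 : Matrix (Fin 5) (Fin 5) ℂ) = A' at *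
  generalize ((g⁻¹).2 : Matrix (Fin 4) (Fin 4) ℂ) = B' at *
  simp only [rho_apply]
  generalize (g.1 : Matrix (Fin 5) (Fin 5) ℂ) = A at *
  generalize (g.2 : Matrix (Fin 4) (Fin 4) ℂ) = B at *
  have had (Y : Alt 5) : ad (A * a * A') (conj A Y) = conj A (ad a Y) := by
    have hA' : Aᵀ * A'ᵀ = 1 := by rw [← transpose_mul, hA, transpose_one]
    ext1
    simp only [ad_coe, conj_coe, transpose_mul, Matrix.mul_add, Matrix.add_mul]
    congr 1
    · calc A * a * A' * (A * Y.1 * Aᵀ) = A * a * (A' * A) * Y.1 * Aᵀ := by noncomm_ring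
        _ = _ := by rw [hA]; noncomm_ring
    · calc A * Y.1 * Aᵀ * (A'ᵀ * (aᵀ * Aᵀ)) = A * Y.1 * (Aᵀ * A'ᵀ) * aᵀ * Aᵀ := by noncomm_ring
        _ = _ := by rw [hA']; noncomm_ring
  have hmix (Y : V) : mix (B * b * B') (mix B Y) = mix B (mix b Y) := by
    rw [← mix_mul, ← mix_mul, Matrix.mul_assoc _ B', hB, Matrix.mul_one]
  have h1 : (fun n => ad (A * a * A') (mix B (fun m => conj A (X m)) n)) =
      mix B fun n => conj A (ad a (X n)) := by
    funext n
    simp only [← had]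
    ext1
    simp only [mix, ad_coe, Submodule.coe_sum, Submodule.coe_smul, Matrix.mul_sum, Matrix.sum_mul,
      Matrix.mul_smul, Matrix.smul_mul, ← Finset.sum_add_distrib, smul_add]
  have h2 : (mix b fun m => conj A (X m)) = fun n => conj A (mix b X n) := by
    funext n
    simp only [mix, map_sum, map_smul]
  simp only [infAct]
  rw [h1, hmix, h2, ← mix_add]
  congr 1
  funext n
  simp only [Pi.add_apply, map_add]

theorem infAct_surjective_of_inOrbit {X : V} (hX : InOrbit X) (Y : V) :
    ∃ a b, infAct a b X = Y := by
  obtain ⟨g, rfl⟩ := hX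
  obtain ⟨a, b, hab⟩ := infAct_base_surjective (rho g⁻¹ Y)
  refine ⟨_, _, (infAct_rho g base a b).trans ?_⟩
  rw [hab, ← Module.End.mul_apply, ← map_mul, mul_inv_cancel, map_one]
  rfl

theorem exists_value_eq_linearMap (l : V →ₗ[ℂ] ℂ) :
    ∃ P : MvPolynomial Coord ℂ, ∀ X, value P X = l X := by
  refine ⟨∑ c, MvPolynomial.C (l (coord.symm (Pi.single c 1))) * MvPolynomial.X c, fun X => ?_⟩
  have h : X = ∑ c, coord X c • coord.symm (Pi.single c 1) := by
    apply coord.injective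
    simp only [map_sum, map_smul, LinearEquiv.apply_symm_apply]
    exact pi_eq_sum_univ' _
  conv_rhs => rw [h]
  simp only [value, map_sum, map_mul, MvPolynomial.eval_C, MvPolynomial.eval_X, map_smul,
    smul_eq_mul]
  exact Finset.sum_congr rfl fun c _ => mul_comm _ _

/-- `infAct` for fixed matrices, as a linear map. -/
def infActLin (a : Matrix (Fin 5) (Fin 5) ℂ) (b : Matrix (Fin 4) (Fin 4) ℂ) : V →ₗ[ℂ] V where
  toFun := infAct a b
  map_add' X Y := by
    simp only [infAct, mix_add]
    funext n
    ext1
    simp only [Pi.add_apply, Submodule.coe_add, ad_coe]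
    noncomm_ring
  map_smul' c X := by
    simp only [infAct, mix_smul]
    funext n
    ext1
    simp [ad_coe]

/-- The equivalence of the Lie algebra, augmented by a line, with the tangent space at the base
point. -/
noncomputable def baseEquiv :
    (Matrix (Fin 5) (Fin 5) ℂ × Matrix (Fin 4) (Fin 4) ℂ) ≃ₗ[ℂ] V × ℂ :=
  LinearEquiv.ofBijective (infMap base) (infMap_bijective infAct_base_surjective)

/-- The determinant of the infinitesimal action. -/
noncomputable def jacobian (X : V) : ℂ :=
  LinearMap.det (baseEquiv.symm.toLinearMap ∘ₗ infMap X)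

theorem exists_value_eq_jacobian :
    ∃ P : MvPolynomial Coord ℂ, ∀ X, value P X = jacobian X := by
  let b := Module.finBasis ℂ (Matrix (Fin 5) (Fin 5) ℂ × Matrix (Fin 4) (Fin 4) ℂ)
  have h : ∀ i j, ∃ P : MvPolynomial Coord ℂ, ∀ X, value P X =
      LinearMap.toMatrix b b (baseEquiv.symm.toLinearMap ∘ₗ infMap X) i j := by
    intro i j
    obtain ⟨P, hP⟩ := exists_value_eq_linearMap
      (b.coord i ∘ₗ baseEquiv.symm.toLinearMap ∘ₗ LinearMap.inl ℂ V ℂ ∘ₗ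
        infActLin (b j).1 (b j).2)
    -- Each matrix entry is affine in `X`: the action part is linear, and the trace part does not
    -- depend on `X`.
    refine ⟨P + MvPolynomial.C (b.coord i (baseEquiv.symm (0, (b j).1.trace))), fun X => ?_⟩
    have e : infMap X (b j) = (infAct (b j).1 (b j).2 X, 0) + (0, (b j).1.trace) := by
      simp [infMap_apply]
    rw [LinearMap.toMatrix_apply, LinearMap.comp_apply, e, map_add, map_add, Finsupp.add_apply,
      value_add, hP, value_C]
    rfl
  choose P hP using h
  refine ⟨(of P).det, fun X => ?_⟩
  rw [jacobian, ← LinearMap.det_toMatrix b, value, RingHom.map_det]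
  congr 1
  ext i j
  exact hP i j X

theorem jacobian_ne_zero_iff (X : V) : jacobian X ≠ 0 ↔ ∀ Y, ∃ a b, infAct a b X = Y := by
  constructor
  · intro h
    rw [← infMap_surjective_iff]
    have := (LinearMap.equivOfDetNeZero _ h).surjective
    intro y
    obtain ⟨w, hw⟩ := this (baseEquiv.symm y)
    exact ⟨w, baseEquiv.symm.injective hw⟩
  · intro h
    let e := (LinearEquiv.ofBijective (infMap X) (infMap_bijective h)).trans baseEquiv.symm
    exact (LinearEquiv.isUnit_det' e).ne_zero

/-- The polynomial `jacobian` has no zeros on the orbit of `base`, so its 40th power is `c f ^ k`;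
hence it cannot vanish where `f` does not. -/
theorem infAct_surjective_of_disc_ne_zero {X : V} (hX : disc X ≠ 0) :
    ∀ Y, ∃ a b, infAct a b X = Y := by
  obtain ⟨P, hP⟩ := exists_value_eq_jacobian
  obtain ⟨c, hc, k, hk⟩ := exists_pow_eq_mul_discPoly_pow (P := P) fun Y hY => by
    rw [hP]
    exact (jacobian_ne_zero_iff Y).2 (infAct_surjective_of_inOrbit hY)
  rw [← jacobian_ne_zero_iff]
  intro h0
  have := congrArg (fun Q => value Q X) hk
  simp only [value_pow, value_mul, value_C, value_discPoly, hP, h0] at this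
  exact mul_ne_zero hc (pow_ne_zero k hX) (by rw [← this]; norm_num)

theorem disc_ne_zero_of_inOrbit {X : V} (hX : InOrbit X) : disc X ≠ 0 := by
  obtain ⟨g, rfl⟩ := hX
  rw [disc_rho]
  refine mul_ne_zero (pow_ne_zero _ g.2.det_ne_zero) ?_
  rw [disc_base]
  norm_num

theorem inOrbit_rho_iff (g : G) (X : V) : InOrbit (rho g X) ↔ InOrbit X := by
  refine ⟨fun h => ?_, fun h => h.rho g⟩
  have := h.rho g⁻¹
  rwa [← Module.End.mul_apply, ← map_mul, inv_mul_cancel, map_one] at this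

/-- On the complex line through `base` and `X`, the points with `f ≠ 0` form a connected set: only
finitely many points are removed from a real plane. Being in the orbit and not being in it are both
open conditions there, since all orbits involved are open. -/
theorem inOrbit_of_disc_ne_zero {X : V} (hX : disc X ≠ 0) : InOrbit X := by
  let γ : ℂ → V := fun z => base + z • (X - base)
  have hγ : Continuous fun z => coord (γ z) := by
    have : (fun z => coord (γ z)) = fun z => coord base + z • coord (X - base) := by
      funext z
      simp only [γ, map_add, map_smul]
    rw [this]
    fun_prop
  have h0 : γ 0 = base := by simp [γ]
  have h1 : γ 1 = X := by simp [γ]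
  obtain ⟨q, hq⟩ := exists_polynomial_of_path discPoly base (X - base) 0 0
  have hq' (z : ℂ) : q.eval z = disc (γ z) := by
    rw [hq, value_discPoly]
    simp [γ]
  have hq0 : q ≠ 0 := by
    rintro rfl
    refine hX ?_
    rw [← h1, ← hq', Polynomial.eval_zero]
  have near {z : ℂ} (hz : disc (γ z) ≠ 0) : ∀ᶠ w in nhds z, ∃ g : G, rho g (γ z) = γ w := by
    filter_upwards [hγ.continuousAt.eventually
      (orbit_mem_nhds (infAct_surjective_of_disc_ne_zero hz))] with w ⟨g, hg⟩
    exact ⟨g, coord.injective hg⟩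
  let S : Set ℂ := {z | q.eval z = 0}
  have hS : S.Countable := by
    have : S = (q.roots.toFinset : Set ℂ) := by
      ext z
      simp [S, hq0]
    rw [this]
    exact Finset.countable_toSet _
  have hconn : IsPreconnected Sᶜ :=
    (hS.isPathConnected_compl_of_one_lt_rank (by
      rw [Complex.rank_real_complex]
      norm_num)).isConnected.isPreconnected
  have hU : IsOpen {z | InOrbit (γ z)} := by
    rw [isOpen_iff_mem_nhds]
    intro z hz
    filter_upwards [near (disc_ne_zero_of_inOrbit hz)] with w ⟨g, hg⟩
    change InOrbit (γ w)
    rw [← hg]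
    exact InOrbit.rho hz g
  have hW : IsOpen {z | disc (γ z) ≠ 0 ∧ ¬InOrbit (γ z)} := by
    rw [isOpen_iff_mem_nhds]
    rintro z ⟨hz, hz'⟩
    filter_upwards [near hz] with w ⟨g, hg⟩
    change disc (γ w) ≠ 0 ∧ ¬InOrbit (γ w)
    rw [← hg, inOrbit_rho_iff, disc_rho]
    exact ⟨mul_ne_zero (pow_ne_zero _ g.2.det_ne_zero) hz, hz'⟩
  have hsub := IsPreconnected.subset_left_of_subset_union hU hW
    (Set.disjoint_left.2 fun z hz hz' => hz'.2 hz) (s := Sᶜ) (fun z hz => by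
      by_cases h : InOrbit (γ z)
      · exact Or.inl h
      · exact Or.inr ⟨by rw [← hq']; exact hz, h⟩)
    ⟨0, by
      change ¬q.eval 0 = 0
      rw [hq', h0]
      exact disc_ne_zero_of_inOrbit inOrbit_base, by
      change InOrbit (γ 0)
      rw [h0]
      exact inOrbit_base⟩ hconn
  have := hsub (show (1 : ℂ) ∈ Sᶜ by
    change ¬q.eval 1 = 0
    rwa [hq', h1])
  rwa [Set.mem_ofPred_eq, h1] at this

theorem isPrehomogeneous : IsPrehomogeneous := by
  refine ⟨{discPoly}, base, ?_⟩
  ext X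
  simp only [Set.mem_singleton_iff, forall_eq, value_discPoly, Set.mem_compl_iff,
    Set.mem_ofPred_eq]
  exact ⟨inOrbit_of_disc_ne_zero, disc_ne_zero_of_inOrbit⟩

/-! ### Irreducibility of `f` and the uniqueness of relative invariants -/

theorem discPoly_ne_zero : discPoly ≠ 0 := by
  intro h
  have := value_discPoly base
  rw [h, disc_base] at this
  simp [value] at this

/-- If `k = 0`, then `P ^ 40` is a nonzero constant. Otherwise `P` vanishes exactly where `f` does.
-/
theorem isUnit_or_exists_pow_eq {P : MvPolynomial Coord ℂ}
    (hP : ∀ X, InOrbit X → value P X ≠ 0) :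
    IsUnit P ∨ ∃ c : ℂ, c ≠ 0 ∧ ∃ k : ℕ, k ≠ 0 ∧ P ^ 40 = MvPolynomial.C c * discPoly ^ k := by
  obtain ⟨c, hc, k, hk⟩ := exists_pow_eq_mul_discPoly_pow hP
  rcases eq_or_ne k 0 with rfl | h
  · left
    rw [pow_zero, mul_one] at hk
    rw [← isUnit_pow_iff (n := 40) (by norm_num), hk]
    exact (isUnit_iff_ne_zero.2 hc).map _
  · exact Or.inr ⟨c, hc, k, h, hk⟩

theorem family_affine (t : ℂ) :
    family 1 t 1 = family 1 0 1 + t • (family 1 1 1 - family 1 0 1) := by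
  funext k
  fin_cases k <;> ext a b <;> fin_cases a <;> fin_cases b <;> simp [family]

theorem discPoly_irreducible : Irreducible discPoly := by
  have hd0 : disc (family 1 0 1) = 0 := by rw [disc_family]; ring
  refine ⟨fun h => ?_, fun a b hab => ?_⟩
  · obtain ⟨r, hr, hC⟩ := MvPolynomial.isUnit_iff_eq_C_of_isReduced.1 h
    have h1 := value_discPoly (family 1 0 1)
    rw [hC, value_C, hd0] at h1
    exact hr.ne_zero h1
  · by_contra! hu
    have hmul (X : V) : value a X * value b X = disc X := by
      rw [← value_mul, ← hab, value_discPoly]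
    have ha (X : V) (hX : InOrbit X) : value a X ≠ 0 :=
      left_ne_zero_of_mul (hmul X ▸ disc_ne_zero_of_inOrbit hX)
    have hb (X : V) (hX : InOrbit X) : value b X ≠ 0 :=
      right_ne_zero_of_mul (hmul X ▸ disc_ne_zero_of_inOrbit hX)
    have root {P : MvPolynomial Coord ℂ} (hP : ∀ X, InOrbit X → value P X ≠ 0)
        (hPu : ¬IsUnit P) : ∃ q : Polynomial ℂ, q.eval 0 = 0 ∧
          ∀ t, q.eval t = value P (family 1 t 1) := by
      obtain ⟨q, hq⟩ := exists_polynomial_of_path P (family 1 0 1)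
        (family 1 1 1 - family 1 0 1) 0 0
      have hq' (t : ℂ) : q.eval t = value P (family 1 t 1) := by
        rw [hq, family_affine t]
        simp
      refine ⟨q, ?_, hq'⟩
      obtain ⟨c, -, k, hk0, hk⟩ := (isUnit_or_exists_pow_eq hP).resolve_left hPu
      have := congrArg (fun Q => value Q (family 1 0 1)) hk
      simp only [value_pow, value_mul, value_C, value_discPoly, hd0, zero_pow hk0, mul_zero] at this
      rw [hq']
      exact pow_eq_zero_iff (by norm_num) |>.1 this
    obtain ⟨q, hq0, hq⟩ := root ha hu.1
    obtain ⟨r, hr0, hr⟩ := root hb hu.2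
    -- Along `family 1 t 1` the product has a simple zero at `t = 0`, while both factors vanish
    -- there; the derivative at `0` gives the contradiction.
    have hqr : q * r = Polynomial.C (-71663616000) * Polynomial.X := by
      refine Polynomial.funext fun t => ?_
      rw [Polynomial.eval_mul, hq, hr, hmul, disc_family]
      simp
    have := congrArg (fun p => (Polynomial.derivative p).eval 0) hqr
    simp [hq0, hr0] at this

theorem isRelativeInvariant_discPoly : IsRelativeInvariant discPoly (detPow 10) := by
  have hd (g : G) : (detPow 10 g : ℂ) = (g.2 : Matrix (Fin 4) (Fin 4) ℂ).det ^ 10 := rfl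
  refine ⟨discPoly_ne_zero, ⟨(of fun i j => MvPolynomial.X (Sum.inr (i, j))).det ^ 10, 0,
    fun g => ?_⟩, fun g X => ?_⟩
  · rw [hd, pow_zero, div_one, map_pow, RingHom.map_det]
    congr 2
    ext i j
    simp
  · rw [value_discPoly, value_discPoly, disc_rho, hd]

/-- A zero at one point of the orbit would spread over the orbit and force `P = 0`. Hence `P ^ 40 =
c f ^ k` with `k ≠ 0`, and the prime `f` divides the irreducible `P`. -/
theorem eq_smul_discPoly {P : MvPolynomial Coord ℂ} {χ : G →* ℂˣ} (hP : Irreducible P)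
    (hχ : IsRelativeInvariant P χ) : ∃ c : ℂ, c ≠ 0 ∧ P = c • discPoly := by
  have hne (X : V) (hX : InOrbit X) : value P X ≠ 0 := by
    have hbase : value P base ≠ 0 := fun h0 => hχ.1 <| eq_of_eqOn_orbit fun Y hY => by
      obtain ⟨g, rfl⟩ := hY
      rw [hχ.2.2, h0, mul_zero, value, map_zero]
    obtain ⟨g, rfl⟩ := hX
    rw [hχ.2.2]
    exact mul_ne_zero (χ g).ne_zero hbase
  obtain ⟨c, -, k, hk0, hk⟩ := (isUnit_or_exists_pow_eq hne).resolve_left hP.not_isUnit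
  have hdvd : discPoly ∣ P := by
    refine discPoly_irreducible.prime.dvd_of_dvd_pow (n := 40) ?_
    rw [hk]
    exact dvd_mul_of_dvd_right (dvd_pow_self _ hk0) _
  obtain ⟨u, hu⟩ := (discPoly_irreducible.associated_of_dvd hP hdvd)
  obtain ⟨r, hr, hC⟩ := MvPolynomial.isUnit_iff_eq_C_of_isReduced.1 u.isUnit
  refine ⟨r, hr.ne_zero, ?_⟩
  rw [← hu, hC, mul_comm, MvPolynomial.smul_eq_C_mul]

/-! ### Surjectivity of `Φ` -/

theorem exists_congr_diagonal {S : Matrix (Fin 4) (Fin 4) ℂ} (hS : Sᵀ = S) :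
    ∃ (w : Fin 4 → Bool) (Q : Matrix (Fin 4) (Fin 4) ℂ), Q.det ≠ 0 ∧
      S = Q * diagonal (fun i => if w i then 1 else 0) * Qᵀ := by
  classical
  obtain ⟨w, hw⟩ : ∃ w : Fin 4 → ℂ, QuadraticMap.Equivalent S.toQuadraticForm'
      (QuadraticMap.weightedSumSquares ℂ w) := by
    have := QuadraticForm.equivalent_weightedSumSquares (S.toQuadraticForm' : QuadraticForm ℂ
        (Fin 4 → ℂ))
    rwa [Module.finrank_fin_fun] at this
  obtain ⟨e⟩ := hw.trans ⟨QuadraticForm.isometryEquivSumSquares w⟩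
  let d : Fin 4 → ℂ := fun i => if w i = 0 then 0 else 1
  let M : Matrix (Fin 4) (Fin 4) ℂ := LinearMap.toMatrix' (e.toLinearEquiv : (Fin 4 → ℂ) →ₗ[ℂ] _)
  have hM (x : Fin 4 → ℂ) : M *ᵥ x = e x := by
    rw [← Matrix.toLin'_apply, Matrix.toLin'_toMatrix']
    rfl
  have hq (x : Fin 4 → ℂ) : x ⬝ᵥ (Mᵀ * diagonal d * M) *ᵥ x = x ⬝ᵥ S *ᵥ x := by
    have h1 := e.map_app x
    rw [QuadraticMap.weightedSumSquares_apply] at h1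
    have h2 : S.toQuadraticForm' x = x ⬝ᵥ S *ᵥ x := by
      exact Matrix.toLinearMap₂'_apply' S x x
    rw [← h2, ← h1, ← mulVec_mulVec, ← mulVec_mulVec, dotProduct_mulVec, vecMul_transpose, hM]
    simp only [dotProduct, mulVec_diagonal, smul_eq_mul, d]
    exact Finset.sum_congr rfl fun i _ => by ring
  have hMS : Mᵀ * diagonal d * M = S := by
    have hsym : (Mᵀ * diagonal d * M)ᵀ = Mᵀ * diagonal d * M := by
      simp [transpose_mul, Matrix.mul_assoc]
    generalize Mᵀ * diagonal d * M = T at *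
    ext i j
    -- Polarization: symmetric matrices with the same quadratic form are equal.
    have h1 := hq (Pi.single i 1 + Pi.single j 1)
    have h2 := hq (Pi.single i 1)
    have h3 := hq (Pi.single j 1)
    have h4 := congrFun (congrFun hsym i) j
    have h5 := congrFun (congrFun hS i) j
    simp [mulVec_add] at h1 h2 h3 h4 h5
    linear_combination (1 / 2) * (h1 - h2 - h3 - h4 + h5)
  refine ⟨fun i => decide (w i ≠ 0), Mᵀ, ?_, ?_⟩
  · rw [det_transpose, LinearMap.det_toMatrix']
    exact (LinearEquiv.isUnit_det' e.toLinearEquiv).ne_zero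
  · rw [← hMS, transpose_transpose]
    congr 3
    funext i
    by_cases h : w i = 0 <;> simp [d, h]

/-- Up to order only the number of ones matters, and the pattern of the family realizes each number
from `0` to `4`. -/
theorem exists_perm_pattern : ∀ w : Fin 4 → Bool, ∃ (σ : Equiv.Perm (Fin 4)) (s t u : Bool),
    ∀ i, w i = ![s, s && t, s && u, s && u] (σ i) := by
  decide

theorem exists_congr_family (s t u : Bool) : ∃ (X : V) (Q : Matrix (Fin 4) (Fin 4) ℂ),
    Q.det ≠ 0 ∧ Q * phiMat X * Qᵀ =
      diagonal fun i => if ![s, s && t, s && u, s && u] i then (1 : ℂ) else 0 := by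
  obtain ⟨x, hx⟩ := IsAlgClosed.exists_pow_nat_eq (-288 : ℂ)⁻¹ (n := 2) (by norm_num)
  obtain ⟨y, hy⟩ := IsAlgClosed.exists_pow_nat_eq (-480 : ℂ)⁻¹ (n := 2) (by norm_num)
  have hx0 : x ≠ 0 := by
    rintro rfl
    norm_num at hx
  have hy0 : y ≠ 0 := by
    rintro rfl
    norm_num at hy
  let c : Bool → ℂ := fun b => if b then 1 else 0
  -- The entries `x, y` normalize `-288` and `-480`; the last two rows are an orthogonal basis for
  -- the hyperbolic block with off-diagonal entry `-720 s u`, each of square `s u`.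
  refine ⟨family (c s) (c t) (c u), !![x, 0, 0, 0; 0, y, 0, 0; 0, 0, 1, -1 / 1440;
    0, 0, Complex.I, Complex.I / 1440], ?_, ?_⟩
  · simp [det_succ_row_zero, Fin.sum_univ_succ, Fin.succAbove, hx0, hy0]
    ring_nf
    simp
  · have e : (fun i => if ![s, s && t, s && u, s && u] i then (1 : ℂ) else 0) =
        ![c s ^ 2, c s * c t, c s * c u, c s * c u] := by
      funext i
      fin_cases i <;> cases s <;> cases t <;> cases u <;> simp [c]
    rw [phiMat_family, e]
    generalize c s = a
    generalize c t = b
    generalize c u = d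
    have h1 : x * x = -1 / 288 := by rw [← sq, hx]; norm_num
    have h2 : y * y = -1 / 480 := by rw [← sq, hy]; norm_num
    ext i j
    fin_cases i <;> fin_cases j <;> simp [Matrix.mul_apply, Fin.sum_univ_four]
    · linear_combination (-288 * a ^ 2) * h1
    · linear_combination (-480 * a * b) * h2
    all_goals try ring1
    all_goals linear_combination (-1 * a * d) * Complex.I_mul_I

theorem Phi_surjective : Function.Surjective Phi := by
  rintro ⟨S, hS⟩
  obtain ⟨w, Q, hQ, hSQ⟩ := exists_congr_diagonal hS
  obtain ⟨σ, s, t, u, hw⟩ := exists_perm_pattern w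
  obtain ⟨X, R, hR, hX⟩ := exists_congr_family s t u
  let E : Matrix (Fin 4) (Fin 4) ℂ := (1 : Matrix (Fin 4) (Fin 4) ℂ).submatrix σ id
  have hE : E.det ≠ 0 := by
    rw [det_permute]
    simp
  have hd : diagonal (fun i => if w i then (1 : ℂ) else 0) =
      E * (R * phiMat X * Rᵀ) * Eᵀ := by
    rw [hX, show Eᵀ = (1 : Matrix (Fin 4) (Fin 4) ℂ).submatrix (Equiv.refl _) σ by
        rw [transpose_submatrix, transpose_one]; rfl,
      show E = (1 : Matrix (Fin 4) (Fin 4) ℂ).submatrix σ (Equiv.refl _) from rfl,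
      one_submatrix_mul, mul_submatrix_one]
    ext i j
    simp [diagonal_apply, hw]
  let C := Q * E * R
  have hC : C.det ≠ 0 := by
    rw [det_mul, det_mul]
    exact mul_ne_zero (mul_ne_zero hQ hE) hR
  -- Replacing `C` by `z C` multiplies `(det C)² C Φ(X) ᵗC` by `z^(8+2)`, so this `z` cancels the
  -- factor `(det C)²`.
  obtain ⟨z, hz⟩ := IsAlgClosed.exists_pow_nat_eq (C.det ^ 2)⁻¹ (n := 10) (by norm_num)
  refine ⟨mix (z • C) X, Subtype.ext ?_⟩
  change phiMat (mix (z • C) X) = S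
  have hS' : S = C * phiMat X * Cᵀ := by
    rw [hSQ, hd]
    simp only [C, transpose_mul, Matrix.mul_assoc]
  rw [phiMat_mix, det_smul, transpose_smul, Matrix.smul_mul, Matrix.smul_mul, Matrix.mul_smul,
    smul_smul, smul_smul, ← hS', Fintype.card_fin]
  have : (z ^ 4 * C.det) ^ 2 * (z * z) = 1 := by
    calc (z ^ 4 * C.det) ^ 2 * (z * z) = z ^ 10 * C.det ^ 2 := by ring
      _ = 1 := by rw [hz, inv_mul_cancel₀ (pow_ne_zero 2 hC)]
  rw [mul_assoc, this, one_smul]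

end QuinaryAlt

theorem mainTheorem8 :
    Function.Surjective QuinaryAlt.Phi ∧
    QuinaryAlt.IsPrehomogeneous ∧
    ∃ f : MvPolynomial QuinaryAlt.Coord ℂ,
      (∀ X : QuinaryAlt.V, QuinaryAlt.value f X = (QuinaryAlt.Phi X).1.det) ∧
      Irreducible f ∧
      f.IsHomogeneous 40 ∧
      QuinaryAlt.IsRelativeInvariant f (QuinaryAlt.detPow 10) ∧
      ∀ (P : MvPolynomial QuinaryAlt.Coord ℂ) (χ : QuinaryAlt.G →* ℂˣ),
        Irreducible P → QuinaryAlt.IsRelativeInvariant P χ →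
          ∃ c : ℂ, c ≠ 0 ∧ P = c • f :=
  ⟨QuinaryAlt.Phi_surjective, QuinaryAlt.isPrehomogeneous, QuinaryAlt.discPoly,
    QuinaryAlt.value_discPoly, QuinaryAlt.discPoly_irreducible,
    QuinaryAlt.discPoly_isHomogeneous, QuinaryAlt.isRelativeInvariant_discPoly,
    fun _ _ hP hχ => QuinaryAlt.eq_smul_discPoly hP hχ⟩
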